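/- Let $d_A,d_B\ge 1$ and let $\mathcal H_A=\mathbb C^{d_A}$, $\mathcal H_B=\mathbb C^{d_B}$ with their computational bases. The Schmidt rank of an operator $U$ on a tensor product $\mathcal K\otimes\mathcal L$ is the number $n$ of terms in an expansion $U=\sum_{j=1}^n A_j\otimes B_j$ with $A_1,\dots,A_n$ linearly independent and $B_1,\dots,B_n$ linearly independent. A standard gate is a unitary on $\mathcal H_A\otimes\mathcal H_B$ of the form $V_{ab}\oplus I$, where $\mathcal H_a\subseteq\mathcal H_A$ and $\mathcal H_b\subseteq\mathcal H_B$ are two-dimensional subspaces, $V_{ab}$ (the nontrivial part) is a unitary of Schmidt rank $2$ on $\mathcal H_a\otimes\mathcal H_b$, and $I$ is the identity on the orthogonal complement of $\mathcal H_a\otimes\mathcal H_b$. A local unitary is an operator $S\otimes T$ with $S$, $T$ unitary; a local permutation gate is an operator $P\otimes Q$ with $P$, $Q$ permutation matrices. An operator $U$ is a product of $n$ gates interspersed with local unitaries (local permutation gates) if $U=L_0G_1L_1\cdots G_nL_n$ with gates $G_i$ and local unitaries (local permutation gates) $L_i$. (i) Every unitary on $\mathcal H_A\otimes\mathcal H_B$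 is a product of at most $$2(d_A-1)^2\left\lfloor\tfrac{d_B}{2}\right\rfloor+(2d_A-3)(d_B-1)\left\lfloor\tfrac{d_A}{2}\right\rfloor$$ standard gates interspersed with local unitaries. (ii) Every controlled unitary controlled from the $A$ side, that is, every operator of the form $K\big(\sum_{j=1}^{d_A}|j\rangle\langle j|\otimes W_j\big)L$ with local unitaries $K$, $L$ and unitaries $W_j$ on $\mathcal H_B$, is a product of at most $(d_A-1)\lfloor d_B/2\rfloor$ standard gates interspersed with local unitaries. (iii) Every complex permutation unitary on $\mathcal H_A\otimes\mathcal H_B$, that is, every unitary matrix in the computational product basis with exactly one nonzero entry in each row and in each column, is a product of at most $2(d_A-1)\lfloor d_B/2\rfloor+(d_B-1)\lfloor d_A/2\rfloor$ standard gates interspersed with local unitaries. (iv) Every permutation matrix on $\mathcal H_A\otimes\mathcal H_B$ (in the computational product basis) is a product of at most $3(d_A-1)(d_B-1)$ standard gates whose nontrivial part is a CNOT, interspersed with local permutation gates. Here each of $\mathcal H_a$, $\mathcal H_b$ is spanned by two computational basis vectors, the CNOT is taken with respect to these, and either party may be the control. -/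

import Mathlib

open Matrix
open scoped Kronecker

/-- Operators on `ℂ^dA ⊗ ℂ^dB`, as matrices in the computational product basis
`|i⟩ ⊗ |j⟩ = |i, j⟩`. -/
abbrev BipartiteMatrix (dA dB : ℕ) : Type :=
  Matrix (Fin dA × Fin dB) (Fin dA × Fin dB) ℂ

/-- `U` has (operator) Schmidt rank `n`: `U = ∑ j, A j ⊗ B j` with `n` terms, the `A j` linearly
independent and the `B j` linearly independent. -/
def HasSchmidtRank {dA dB : ℕ} (U : BipartiteMatrix dA dB) (n : ℕ) : Prop :=
  ∃ (A : Fin n → Matrix (Fin dA) (Fin dA) ℂ) (B : Fin n → Matrix (Fin dB) (Fin dB) ℂ),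
    LinearIndependent ℂ A ∧ LinearIndependent ℂ B ∧ U = ∑ j, A j ⊗ₖ B j

/-- Local unitaries `S ⊗ T`. -/
def IsLocalUnitary {dA dB : ℕ} (L : BipartiteMatrix dA dB) : Prop :=
  ∃ S ∈ unitaryGroup (Fin dA) ℂ, ∃ T ∈ unitaryGroup (Fin dB) ℂ, L = S ⊗ₖ T

/-- Local permutation gates `P ⊗ Q`, with `P` and `Q` permutation matrices. -/
def IsLocalPermutation {dA dB : ℕ} (L : BipartiteMatrix dA dB) : Prop :=
  ∃ (σ : Equiv.Perm (Fin dA)) (τ : Equiv.Perm (Fin dB)),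
    L = σ.permMatrix ℂ ⊗ₖ τ.permMatrix ℂ

/-- `V_{ab} ⊕ I`: the operator acting as `V` on `ℋ_a ⊗ ℋ_b` and as the identity on its orthogonal
complement, where `ℋ_a`, `ℋ_b` are the column spaces of `E`, `F` and their (orthonormal) columns
identify them with `ℂ²`. -/
noncomputable def extendGate {dA dB : ℕ} (E : Matrix (Fin dA) (Fin 2) ℂ)
    (F : Matrix (Fin dB) (Fin 2) ℂ) (V : BipartiteMatrix 2 2) : BipartiteMatrix dA dB :=
  (E ⊗ₖ F) * V * (E ⊗ₖ F)ᴴ + (1 - (E ⊗ₖ F) * (E ⊗ₖ F)ᴴ)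

/-- Standard gates: `V_{ab} ⊕ I` with two-dimensional subspaces `ℋ_a ⊆ ℂ^dA`, `ℋ_b ⊆ ℂ^dB`
(spanned by the orthonormal columns of `E` and `F`) and a unitary `V_{ab}` on `ℋ_a ⊗ ℋ_b` of
Schmidt rank two. -/
def IsStandardGate {dA dB : ℕ} (G : BipartiteMatrix dA dB) : Prop :=
  ∃ (E : Matrix (Fin dA) (Fin 2) ℂ) (F : Matrix (Fin dB) (Fin 2) ℂ) (V : BipartiteMatrix 2 2),
    Eᴴ * E = 1 ∧ Fᴴ * F = 1 ∧
    V ∈ unitaryGroup (Fin 2 × Fin 2) ℂ ∧ HasSchmidtRank V 2 ∧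
    G = extendGate E F V

/-- The matrix whose columns are the computational basis vectors `|a 0⟩` and `|a 1⟩`. -/
def basisFrame {d : ℕ} (a : Fin 2 ↪ Fin d) : Matrix (Fin d) (Fin 2) ℂ :=
  Matrix.of fun i s => if i = a s then 1 else 0

/-- The two-qubit CNOT with control on the first qubit. -/
def cnotA : BipartiteMatrix 2 2 :=
  !![1, 0; 0, 0] ⊗ₖ !![1, 0; 0, 1] + !![0, 0; 0, 1] ⊗ₖ !![0, 1; 1, 0]

/-- The two-qubit CNOT with control on the second qubit. -/
def cnotB : BipartiteMatrix 2 2 :=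
  !![1, 0; 0, 1] ⊗ₖ !![1, 0; 0, 0] + !![0, 1; 1, 0] ⊗ₖ !![0, 0; 0, 1]

/-- Standard gates whose nontrivial part is a CNOT in the computational basis (with either party
as the control): `ℋ_a` and `ℋ_b` are each spanned by two computational basis vectors. -/
def IsCNOTGate {dA dB : ℕ} (G : BipartiteMatrix dA dB) : Prop :=
  ∃ (a : Fin 2 ↪ Fin dA) (b : Fin 2 ↪ Fin dB),
    G = extendGate (basisFrame a) (basisFrame b) cnotA ∨
    G = extendGate (basisFrame a) (basisFrame b) cnotB

/-- `U = L₀ G₁ L₁ G₂ L₂ ⋯ Gₙ Lₙ` with every `Gᵢ` satisfying `gate` and every `Lᵢ` satisfying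
`loc`: a product of `n` gates interspersed with local operations. -/
def IsProductOfGates {dA dB : ℕ} (gate loc : BipartiteMatrix dA dB → Prop) (n : ℕ)
    (U : BipartiteMatrix dA dB) : Prop :=
  ∃ (L : Fin (n + 1) → BipartiteMatrix dA dB) (G : Fin n → BipartiteMatrix dA dB),
    (∀ i, loc (L i)) ∧ (∀ i, gate (G i)) ∧
    U = L 0 * (List.ofFn fun i : Fin n => G i * L i.succ).prod

/-- Controlled unitaries controlled from the `A` side: equivalent, under local unitaries on both
sides, to `∑ j, |j⟩⟨j| ⊗ W j` with unitary `W j`. -/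
def IsControlledFromA {dA dB : ℕ} (U : BipartiteMatrix dA dB) : Prop :=
  ∃ (K L : BipartiteMatrix dA dB) (W : Fin dA → Matrix (Fin dB) (Fin dB) ℂ),
    IsLocalUnitary K ∧ IsLocalUnitary L ∧ (∀ j, W j ∈ unitaryGroup (Fin dB) ℂ) ∧
    U = K * (∑ j, Matrix.single j j (1 : ℂ) ⊗ₖ W j) * L

/-- Complex permutation unitaries: unitary matrices, in the computational product basis, with one
and only one nonzero entry in each row and in each column. -/
def IsComplexPermutation {dA dB : ℕ} (U : BipartiteMatrix dA dB) : Prop :=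
  U ∈ unitaryGroup (Fin dA × Fin dB) ℂ ∧
    (∀ i, ∃! j, U i j ≠ 0) ∧ (∀ j, ∃! i, U i j ≠ 0)

/-!
A unitary controlled from `A` is a product of `dA` unitaries acting on `B` for a single control
state each, and one of them is made trivial by a local unitary. Up to local unitaries and a phase on
the control, each remaining one is diagonal, and pairing the eigenphases splits it into `dB / 2`
standard gates.

A permutation of a grid permutes the points within each row, then within each column, then within
each row: König's edge-colouring theorem for regular bipartite multigraphs chooses the intermediate
position. This gives a product of three controlled permutations, and a complex permutation
differs from it by a diagonal factor that the first one absorbs.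

A unitary on a split first party `ℂ^(a + b) ⊗ ℂ^dB` is, by the cosine–sine decomposition, a product
of two direct sums with a unitary controlled from `B` in between. Repeated halving of `dA` leads to
`2 ^ ⌈log₂ dA⌉ ≤ 2 * (dA - 1)` unitaries controlled from `A`, separated by unitaries controlled
from `B`.
-/

section Products

variable {dA dB : ℕ} {gate loc : BipartiteMatrix dA dB → Prop} {n : ℕ} {U : BipartiteMatrix dA dB}

theorem isProductOfGates_zero : IsProductOfGates gate loc 0 U ↔ loc U := by
  constructor
  · rintro ⟨L, G, hL, -, rfl⟩
    simpa using hL 0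
  · intro h
    exact ⟨fun _ => U, Fin.elim0, fun _ => h, fun i => i.elim0, by simp⟩

theorem isProductOfGates_succ : IsProductOfGates gate loc (n + 1) U ↔
    ∃ L G V, loc L ∧ gate G ∧ IsProductOfGates gate loc n V ∧ U = L * G * V := by
  constructor
  · rintro ⟨L, G, hL, hG, rfl⟩
    refine ⟨L 0, G 0, _, hL 0, hG 0,
      ⟨fun i => L i.succ, fun i => G i.succ, fun i => hL _, fun i => hG _, rfl⟩, ?_⟩
    simp [List.ofFn_succ, mul_assoc]
  · rintro ⟨L, G, V, hL, hG, ⟨L', G', hL', hG', rfl⟩, rfl⟩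
    refine ⟨Fin.cons L L', Fin.cons G G', ?_, ?_, ?_⟩
    · intro i; cases i using Fin.cases <;> simp [hL, hL']
    · intro i; cases i using Fin.cases <;> simp [hG, hG']
    · simp [List.ofFn_succ, mul_assoc]

/-- `U` is a product of at most `n` gates interspersed with local operations. The admissible local
operations are bundled as a submonoid, so that such products can be concatenated. -/
def IsProductOfAtMost (gate : BipartiteMatrix dA dB → Prop)
    (loc : Submonoid (BipartiteMatrix dA dB)) (n : ℕ) (U : BipartiteMatrix dA dB) : Prop :=
  ∃ k ≤ n, IsProductOfGates gate (· ∈ loc) k U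

namespace IsProductOfAtMost

variable {loc : Submonoid (BipartiteMatrix dA dB)} {k : ℕ} {L V : BipartiteMatrix dA dB}

theorem mono (h : IsProductOfAtMost gate loc n U) (hk : n ≤ k) :
    IsProductOfAtMost gate loc k U :=
  let ⟨l, hl, h⟩ := h
  ⟨l, hl.trans hk, h⟩

theorem of_mem (h : U ∈ loc) : IsProductOfAtMost gate loc n U :=
  ⟨0, n.zero_le, isProductOfGates_zero.2 h⟩

theorem of_gate (h : gate U) : IsProductOfAtMost gate loc 1 U :=
  ⟨1, le_rfl, isProductOfGates_succ.2
    ⟨1, U, 1, loc.one_mem, h, isProductOfGates_zero.2 loc.one_mem, by simp⟩⟩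

theorem local_mul (hL : L ∈ loc) (hU : IsProductOfAtMost gate loc n U) :
    IsProductOfAtMost gate loc n (L * U) := by
  obtain ⟨k, hk, hU⟩ := hU
  refine ⟨k, hk, ?_⟩
  cases k with
  | zero => exact isProductOfGates_zero.2 (mul_mem hL (isProductOfGates_zero.1 hU))
  | succ k =>
    obtain ⟨K, G, V, hK, hG, hV, rfl⟩ := isProductOfGates_succ.1 hU
    exact isProductOfGates_succ.2 ⟨L * K, G, V, mul_mem hL hK, hG, hV, by simp only [mul_assoc]⟩

theorem gate_mul {G : BipartiteMatrix dA dB} (hG : gate G)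
    (hU : IsProductOfAtMost gate loc n U) : IsProductOfAtMost gate loc (n + 1) (G * U) := by
  obtain ⟨k, hk, hU⟩ := hU
  exact ⟨k + 1, by gcongr, isProductOfGates_succ.2 ⟨1, G, U, loc.one_mem, hG, hU, by simp⟩⟩

protected theorem mul (hU : IsProductOfAtMost gate loc n U) (hV : IsProductOfAtMost gate loc k V) :
    IsProductOfAtMost gate loc (n + k) (U * V) := by
  obtain ⟨l, hl, hU⟩ := hU
  induction l generalizing n U with
  | zero => exact (hV.local_mul (isProductOfGates_zero.1 hU)).mono (Nat.le_add_left k n)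
  | succ l ih =>
    obtain ⟨L, G, U', hL, hG, hU', rfl⟩ := isProductOfGates_succ.1 hU
    rw [mul_assoc, mul_assoc]
    exact (((ih le_rfl hU').gate_mul hG).local_mul hL).mono (by lia)

theorem mul_local (hL : L ∈ loc) (hU : IsProductOfAtMost gate loc n U) :
    IsProductOfAtMost gate loc n (U * L) :=
  hU.mul (of_mem (n := 0) hL)

theorem list_prod {l : List (BipartiteMatrix dA dB)}
    (h : ∀ U ∈ l, IsProductOfAtMost gate loc n U) :
    IsProductOfAtMost gate loc (l.length * n) l.prod := by
  induction l with
  | nil => exact of_mem loc.one_mem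
  | cons U l ih =>
    rw [List.forall_mem_cons] at h
    rw [List.prod_cons, List.length_cons, Nat.succ_mul, add_comm]
    exact h.1.mul (ih h.2)

end IsProductOfAtMost

end Products

section Local

variable (dA dB : ℕ)

/-- The monoid of local unitaries, for use as the local operations in `IsProductOfAtMost`. -/
def localUnitaries : Submonoid (BipartiteMatrix dA dB) where
  carrier := {L | IsLocalUnitary L}
  one_mem' := ⟨1, one_mem _, 1, one_mem _, by simp⟩
  mul_mem' := by
    rintro _ _ ⟨S, hS, T, hT, rfl⟩ ⟨S', hS', T', hT', rfl⟩
    exact ⟨S * S', mul_mem hS hS', T * T', mul_mem hT hT', by rw [mul_kronecker_mul]⟩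

/-- The monoid of local permutation gates, for use as the local operations in
`IsProductOfAtMost`. -/
def localPermutations : Submonoid (BipartiteMatrix dA dB) where
  carrier := {L | IsLocalPermutation L}
  one_mem' := ⟨1, 1, by simp⟩
  mul_mem' := by
    rintro _ _ ⟨σ, τ, rfl⟩ ⟨σ', τ', rfl⟩
    exact ⟨σ' * σ, τ' * τ, by rw [← mul_kronecker_mul, permMatrix_mul, permMatrix_mul]⟩

variable {dA dB : ℕ} {S : Matrix (Fin dA) (Fin dA) ℂ} {T : Matrix (Fin dB) (Fin dB) ℂ}

theorem kronecker_mem_localUnitaries (hS : S ∈ unitaryGroup (Fin dA) ℂ)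
    (hT : T ∈ unitaryGroup (Fin dB) ℂ) : S ⊗ₖ T ∈ localUnitaries dA dB :=
  ⟨S, hS, T, hT, rfl⟩

theorem one_kronecker_mem_localUnitaries (hT : T ∈ unitaryGroup (Fin dB) ℂ) :
    1 ⊗ₖ T ∈ localUnitaries dA dB :=
  kronecker_mem_localUnitaries (one_mem _) hT

theorem kronecker_one_mem_localUnitaries (hS : S ∈ unitaryGroup (Fin dA) ℂ) :
    S ⊗ₖ 1 ∈ localUnitaries dA dB :=
  kronecker_mem_localUnitaries hS (one_mem _)

end Local

section Controlled

variable {m n R : Type*} [Fintype m] [Fintype n] [DecidableEq m] [DecidableEq n]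

section CommSemiring

variable [CommSemiring R]

/-- The exchange of the two parties, which carries every result about operators controlled from the
first party over to operators controlled from the second one. -/
def swapParties : Matrix (m × n) (m × n) R ≃ₐ[R] Matrix (n × m) (n × m) R :=
  reindexAlgEquiv R R (Equiv.prodComm m n)

/-- The operator `∑ i, |i⟩⟨i| ⊗ W i`, controlled from the first party. Mathlib's `blockDiagonal`
puts the index of the block second, which makes it `controlledB` here. -/
def controlledA : (m → Matrix n n R) →+* Matrix (m × n) (m × n) R :=
  (swapParties : _ ≃ₐ[R] _).toRingEquiv.toRingHom.comp (blockDiagonalRingHom n m R)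

/-- The operator `∑ j, V j ⊗ |j⟩⟨j|`, controlled from the second party. -/
def controlledB : (n → Matrix m m R) →+* Matrix (m × n) (m × n) R :=
  blockDiagonalRingHom m n R

theorem swapParties_kronecker (A : Matrix m m R) (B : Matrix n n R) :
    swapParties (A ⊗ₖ B) = B ⊗ₖ A := by
  ext ⟨i, j⟩ ⟨i', j'⟩
  exact mul_comm _ _

theorem swapParties_controlledA (W : m → Matrix n n R) :
    swapParties (controlledA W) = controlledB W :=
  rfl

theorem controlledA_apply (W : m → Matrix n n R) (x y : m × n) :
    controlledA W x y = if x.1 = y.1 then W x.1 x.2 y.2 else 0 :=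
  blockDiagonal_apply W x.swap y.swap

theorem controlledB_apply (V : n → Matrix m m R) (x y : m × n) :
    controlledB V x y = if x.2 = y.2 then V x.2 x.1 y.1 else 0 :=
  blockDiagonal_apply V x y

theorem controlledA_const (T : Matrix n n R) : controlledA (fun _ : m => T) = 1 ⊗ₖ T := by
  ext ⟨i, j⟩ ⟨i', j'⟩
  simp [controlledA_apply, one_apply]

theorem controlledA_diagonal (d : m × n → R) :
    controlledA (fun i => diagonal fun j => d (i, j)) = diagonal d := by
  ext ⟨i, j⟩ ⟨i', j'⟩
  simp only [controlledA_apply, diagonal_apply, Prod.mk.injEq, ite_and]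

theorem controlledA_eq_sum (W : m → Matrix n n R) :
    controlledA W = ∑ i, Matrix.single i i (1 : R) ⊗ₖ W i := by
  ext ⟨i, j⟩ ⟨i', j'⟩
  rw [Matrix.sum_apply, Finset.sum_eq_single i]
  · simp [controlledA_apply, single_apply]
  · intro k _ hk
    simp [hk]
  · simp

theorem controlledA_permMatrix (σ : m → Equiv.Perm n) :
    controlledA (fun i => (σ i).permMatrix R) =
      Equiv.Perm.permMatrix R (Equiv.prodCongrRight σ) := by
  ext ⟨i, j⟩ ⟨i', j'⟩
  simp [controlledA_apply, PEquiv.toMatrix_apply, ite_and]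

theorem controlledB_permMatrix (τ : n → Equiv.Perm m) :
    controlledB (fun j => (τ j).permMatrix R) =
      Equiv.Perm.permMatrix R (Equiv.prodCongrLeft τ) := by
  ext ⟨i, j⟩ ⟨i', j'⟩
  simp [controlledB_apply, PEquiv.toMatrix_apply, ite_and, and_comm]

end CommSemiring

variable [CommRing R]

theorem controlledA_mulSingle (i : m) (T : Matrix n n R) :
    controlledA (Pi.mulSingle i T) = 1 + Matrix.single i i (1 : R) ⊗ₖ (T - 1) := by
  rw [← sub_eq_iff_eq_add', ← map_one (controlledA (m := m)), ← map_sub, controlledA_eq_sum,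
    Finset.sum_eq_single i]
  · simp
  · intro k _ hk
    simp [hk]
  · simp

variable [StarRing R]

theorem swapParties_conjTranspose (U : Matrix (m × n) (m × n) R) :
    swapParties Uᴴ = (swapParties U)ᴴ :=
  rfl

theorem controlledA_conjTranspose (W : m → Matrix n n R) :
    controlledA (fun i => (W i)ᴴ) = (controlledA W)ᴴ := by
  ext ⟨i, j⟩ ⟨i', j'⟩
  by_cases h : i = i' <;> simp [controlledA_apply, h, Ne.symm]

theorem swapParties_mem_unitaryGroup {U : Matrix (m × n) (m × n) R}
    (hU : U ∈ unitaryGroup (m × n) R) : swapParties U ∈ unitaryGroup (n × m) R := by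
  rw [mem_unitaryGroup_iff, star_eq_conjTranspose] at hU ⊢
  rw [← swapParties_conjTranspose, ← map_mul, hU, map_one]

theorem controlledA_mem_unitaryGroup {W : m → Matrix n n R} (hW : ∀ i, W i ∈ unitaryGroup n R) :
    controlledA W ∈ unitaryGroup (m × n) R := by
  rw [mem_unitaryGroup_iff, star_eq_conjTranspose, ← controlledA_conjTranspose, ← map_mul,
    ← map_one controlledA]
  congr 1
  ext1 i
  exact mem_unitaryGroup_iff.1 (hW i)

theorem controlledB_mem_unitaryGroup {V : n → Matrix m m R} (hV : ∀ j, V j ∈ unitaryGroup m R) :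
    controlledB V ∈ unitaryGroup (m × n) R := by
  rw [← swapParties_controlledA]
  exact swapParties_mem_unitaryGroup (controlledA_mem_unitaryGroup hV)

end Controlled

section ControlledCount

variable {dA dB : ℕ} {gate : BipartiteMatrix dA dB → Prop} {loc : Submonoid (BipartiteMatrix dA dB)}
  {G : Type*} [Group G] {φ : G →* Matrix (Fin dB) (Fin dB) ℂ} {z : Fin dA} {N : ℕ}

theorem IsProductOfAtMost.controlledA_of_support
    (h : ∀ j ≠ z, ∀ g, IsProductOfAtMost gate loc N (controlledA (Pi.mulSingle j (φ g))))
    (s : Finset (Fin dA)) (hz : z ∉ s) {g : Fin dA → G} (hg : ∀ i ∉ s, g i = 1) :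
    IsProductOfAtMost gate loc (s.card * N) (controlledA fun i => φ (g i)) := by
  induction s using Finset.induction_on generalizing g with
  | empty =>
    obtain rfl : g = 1 := funext fun i => hg i (Finset.notMem_empty i)
    have hone : (fun i => φ ((1 : Fin dA → G) i)) = 1 := funext fun _ => map_one φ
    rw [hone, map_one]
    exact of_mem loc.one_mem
  | insert j s hj ih =>
    rw [Finset.mem_insert, not_or] at hz
    have hsplit : (fun i => φ (g i)) =
        Pi.mulSingle j (φ (g j)) * fun i => φ (Function.update g j 1 i) := by
      ext1 i
      obtain rfl | hi := eq_or_ne i j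
      · simp
      · simp [hi]
    rw [hsplit, map_mul, Finset.card_insert_of_notMem hj, Nat.succ_mul, add_comm]
    refine (h j (Ne.symm hz.1) _).mul (ih hz.2 fun i hi => ?_)
    obtain rfl | hij := eq_or_ne i j
    · exact Function.update_self ..
    · rw [Function.update_of_ne hij, hg i (by simp [hij, hi])]

/-- The local operation `1 ⊗ φ (g z)` makes one of the `dA` control values trivial. -/
theorem IsProductOfAtMost.controlledA_of_mulSingle (hφ : ∀ g, 1 ⊗ₖ φ g ∈ loc)
    (h : ∀ i j, i ≠ j → ∀ g, IsProductOfAtMost gate loc N (controlledA (Pi.mulSingle j (φ g))))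
    (g : Fin dA → G) :
    IsProductOfAtMost gate loc ((dA - 1) * N) (controlledA fun i => φ (g i)) := by
  obtain rfl | hA := Nat.eq_zero_or_pos dA
  · rw [Subsingleton.elim (fun i => φ (g i)) 1, map_one]
    exact of_mem loc.one_mem
  let z : Fin dA := ⟨0, hA⟩
  have hsplit : (fun i => φ (g i)) = (fun _ => φ (g z)) * fun i => φ ((g z)⁻¹ * g i) := by
    ext1 i
    simp [← map_mul]
  have hcard : (Finset.univ.erase z).card = dA - 1 := by simp
  rw [hsplit, map_mul, controlledA_const, ← hcard]
  exact local_mul (hφ _) (controlledA_of_support (h z · <| ·.symm) _ (by simp) (by simp))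

end ControlledCount

section ExtendByOne

variable {m m' k k' R : Type*} [Fintype k] [Fintype k'] [DecidableEq m] [DecidableEq m']
  [CommRing R] [StarRing R]

/-- The operator acting as `D` on the space spanned by the orthonormal columns of `F` and as the
identity on its orthogonal complement. The gate `extendGate E F V` is `extendByOne (E ⊗ₖ F) V`. -/
def extendByOne (F : Matrix m k R) (D : Matrix k k R) : Matrix m m R :=
  F * D * Fᴴ + (1 - F * Fᴴ)

theorem extendByOne_eq_one_add [DecidableEq k] (F : Matrix m k R) (D : Matrix k k R) :
    extendByOne F D = 1 + F * (D - 1) * Fᴴ := by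
  rw [extendByOne, Matrix.mul_sub, Matrix.sub_mul, Matrix.mul_one]
  abel

theorem extendByOne_reindex (e : m ≃ m') (f : k ≃ k') (F : Matrix m k R) (D : Matrix k k R) :
    extendByOne (reindex e f F) (reindex f f D) = reindex e e (extendByOne F D) := by
  ext i j
  simp only [extendByOne, reindex_apply, conjTranspose_submatrix, submatrix_mul_equiv,
    Matrix.add_apply, Matrix.sub_apply, submatrix_apply, one_apply, e.symm.injective.eq_iff]

end ExtendByOne

section BasisFrame

variable {dA dB : ℕ} (a : Fin 2 ↪ Fin dA) (b : Fin 2 ↪ Fin dB)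

theorem basisFrame_conjTranspose_mul_self : (basisFrame a)ᴴ * basisFrame a = 1 := by
  ext s t
  simp [mul_apply, basisFrame, one_apply, apply_ite, eq_comm]

theorem basisFrame_mul_single_mul_conjTranspose (s t : Fin 2) (c : ℂ) :
    basisFrame a * single s t c * (basisFrame a)ᴴ = single (a s) (a t) c := by
  ext k l
  by_cases hk : k = a s <;> by_cases hl : l = a t <;>
    fin_cases t <;> simp_all [mul_apply, basisFrame, single_apply, ite_and, eq_comm]

theorem extendByOne_basisFrame (D : Matrix (Fin 2) (Fin 2) ℂ) :
    extendByOne (basisFrame a) D = 1 + ∑ s, ∑ t, single (a s) (a t) ((D - 1) s t) := by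
  rw [extendByOne_eq_one_add]
  conv_lhs => rw [matrix_eq_sum_single (D - 1)]
  simp only [Matrix.mul_sum, Matrix.sum_mul, basisFrame_mul_single_mul_conjTranspose]

theorem extendByOne_basisFrame_diagonal (v : Fin 2 → ℂ) :
    extendByOne (basisFrame a) (diagonal v) =
      diagonal (Pi.mulSingle (a 0) (v 0) * Pi.mulSingle (a 1) (v 1)) := by
  have h : a 0 ≠ a 1 := a.injective.ne Fin.zero_ne_one
  ext k l
  obtain rfl | hkl := eq_or_ne k l
  · obtain rfl | h0 := eq_or_ne k (a 0)
    · simp [extendByOne_basisFrame, h, h.symm]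
    · obtain rfl | h1 := eq_or_ne k (a 1)
      · simp [extendByOne_basisFrame, h, h.symm]
      · simp [extendByOne_basisFrame, h0, h1, h0.symm, h1.symm]
  · have hs (i : Fin dA) (c : ℂ) : single i i c k l = 0 :=
      single_apply_of_ne _ _ _ _ _ fun h => hkl (h.1.symm.trans h.2)
    simp [extendByOne_basisFrame, hkl, hs]

theorem extendByOne_basisFrame_swap :
    extendByOne (basisFrame a) !![0, 1; 1, 0] = (Equiv.swap (a 0) (a 1)).permMatrix ℂ := by
  have h : a 0 ≠ a 1 := a.injective.ne Fin.zero_ne_one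
  ext k l
  simp only [extendByOne_basisFrame, Fin.sum_univ_two, Equiv.Perm.permMatrix,
    PEquiv.toMatrix_toPEquiv_apply, Matrix.add_apply, single_apply, one_apply, Pi.single_apply]
  obtain rfl | h0 := eq_or_ne k (a 0)
  · obtain rfl | hl := eq_or_ne l (a 0) <;> simp [*, h.symm, eq_comm]
  · obtain rfl | h1 := eq_or_ne k (a 1)
    · obtain rfl | hl := eq_or_ne l (a 1) <;> simp [*, eq_comm]
    · simp [h0.symm, h1.symm, Equiv.swap_apply_of_ne_of_ne h0 h1, eq_comm]

theorem extendGate_controlledA_mulSingle (F : Matrix (Fin dB) (Fin 2) ℂ)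
    (D : Matrix (Fin 2) (Fin 2) ℂ) :
    extendGate (basisFrame a) F (controlledA (Pi.mulSingle 1 D)) =
      controlledA (Pi.mulSingle (a 1) (extendByOne F D)) := by
  change extendByOne (basisFrame a ⊗ₖ F) _ = _
  rw [extendByOne_eq_one_add, controlledA_mulSingle, controlledA_mulSingle, add_sub_cancel_left,
    conjTranspose_kronecker, ← mul_kronecker_mul, ← mul_kronecker_mul,
    basisFrame_mul_single_mul_conjTranspose, extendByOne_eq_one_add, add_sub_cancel_left]

end BasisFrame

section SwapGates

variable {dA dB : ℕ}

theorem swapParties_extendGate (E : Matrix (Fin dA) (Fin 2) ℂ) (F : Matrix (Fin dB) (Fin 2) ℂ)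
    (V : BipartiteMatrix 2 2) :
    swapParties (extendGate E F V) = extendGate F E (swapParties V) := by
  have h : reindex (Equiv.prodComm _ _) (Equiv.prodComm _ _) (E ⊗ₖ F) = F ⊗ₖ E := by
    ext ⟨i, j⟩ ⟨i', j'⟩
    exact mul_comm _ _
  exact (extendByOne_reindex _ _ (E ⊗ₖ F) V).symm.trans (congrArg (extendByOne · _) h)

theorem swapParties_cnotA : swapParties cnotA = cnotB := by
  rw [cnotA, map_add, swapParties_kronecker, swapParties_kronecker, cnotB]

theorem swapParties_cnotB : swapParties cnotB = cnotA := by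
  rw [cnotB, map_add, swapParties_kronecker, swapParties_kronecker, cnotA]

theorem HasSchmidtRank.swapParties {U : BipartiteMatrix dA dB} {n : ℕ} (h : HasSchmidtRank U n) :
    HasSchmidtRank (swapParties U) n := by
  obtain ⟨A, B, hA, hB, rfl⟩ := h
  exact ⟨B, A, hB, hA, by simp only [map_sum, swapParties_kronecker]⟩

theorem IsStandardGate.swapParties {U : BipartiteMatrix dA dB} (h : IsStandardGate U) :
    IsStandardGate (swapParties U) := by
  obtain ⟨E, F, V, hE, hF, hV, hr, rfl⟩ := h
  exact ⟨F, E, _, hF, hE, swapParties_mem_unitaryGroup hV, hr.swapParties,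
    swapParties_extendGate E F V⟩

theorem IsCNOTGate.swapParties {U : BipartiteMatrix dA dB} (h : IsCNOTGate U) :
    IsCNOTGate (swapParties U) := by
  obtain ⟨a, b, rfl | rfl⟩ := h
  · exact ⟨b, a, .inr (by rw [swapParties_extendGate, swapParties_cnotA])⟩
  · exact ⟨b, a, .inl (by rw [swapParties_extendGate, swapParties_cnotB])⟩

theorem swapParties_mem_localUnitaries {U : BipartiteMatrix dA dB} (h : U ∈ localUnitaries dA dB) :
    swapParties U ∈ localUnitaries dB dA := by
  obtain ⟨S, hS, T, hT, rfl⟩ := h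
  exact ⟨T, hT, S, hS, swapParties_kronecker S T⟩

theorem swapParties_mem_localPermutations {U : BipartiteMatrix dA dB}
    (h : U ∈ localPermutations dA dB) : swapParties U ∈ localPermutations dB dA := by
  obtain ⟨σ, τ, rfl⟩ := h
  exact ⟨τ, σ, swapParties_kronecker _ _⟩

theorem IsProductOfAtMost.swapParties {gate : BipartiteMatrix dA dB → Prop}
    {gate' : BipartiteMatrix dB dA → Prop} {loc : Submonoid (BipartiteMatrix dA dB)}
    {loc' : Submonoid (BipartiteMatrix dB dA)} {n : ℕ} {U : BipartiteMatrix dA dB}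
    (h : IsProductOfAtMost gate loc n U) (hg : ∀ {U}, gate U → gate' (swapParties U))
    (hl : ∀ {U}, U ∈ loc → _root_.swapParties U ∈ loc') :
    IsProductOfAtMost gate' loc' n (_root_.swapParties U) := by
  obtain ⟨k, hk, L, G, hL, hG, rfl⟩ := h
  refine ⟨k, hk, fun i => _root_.swapParties (L i), fun i => _root_.swapParties (G i),
    fun i => hl (hL i), fun i => hg (hG i), ?_⟩
  simp only [map_mul, map_list_prod, List.map_ofFn, Function.comp_def]

end SwapGates

section SingleControl

variable {dA dB : ℕ}

/-- The Schmidt terms are `|0⟩⟨0| ⊗ 1` and `|1⟩⟨1| ⊗ D`. -/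
theorem hasSchmidtRank_two_controlledA_mulSingle {D : Matrix (Fin dB) (Fin dB) ℂ}
    (hD : LinearIndependent ℂ ![1, D]) :
    HasSchmidtRank (controlledA (Pi.mulSingle (1 : Fin 2) D)) 2 := by
  refine ⟨fun s => single s s 1, ![1, D], ?_, hD, ?_⟩
  · have := (Matrix.stdBasis ℂ (Fin 2) (Fin 2)).linearIndependent.comp (fun s => (s, s))
      fun s t h => congrArg Prod.fst h
    simpa [Function.comp_def, stdBasis_eq_single] using this
  · have h : Pi.mulSingle 1 D = ![1, D] := by
      ext1 s
      fin_cases s <;> simp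
    rw [controlledA_eq_sum, h]

theorem linearIndependent_one_diagonal {n : Type*} [DecidableEq n] {v : n → ℂ} {i j : n}
    (h : v i ≠ v j) : LinearIndependent ℂ ![1, diagonal v] := by
  rw [LinearIndependent.pair_iff]
  intro s t hst
  have hi : s + t * v i = 0 := by simpa using congrFun (congrFun hst i) i
  have hj : s + t * v j = 0 := by simpa using congrFun (congrFun hst j) j
  have ht : t = 0 := by
    have : t * (v i - v j) = 0 := by linear_combination hi - hj
    exact (mul_eq_zero.1 this).resolve_right (sub_ne_zero.2 h)
  exact ⟨by simpa [ht] using hi, ht⟩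

theorem isStandardGate_controlledA_mulSingle_diagonal {i j : Fin dA} (hij : i ≠ j) {p q : Fin dB}
    (hpq : p ≠ q) {x y : ℂ} (hxy : x ≠ y) (hU : diagonal ![x, y] ∈ unitaryGroup (Fin 2) ℂ) :
    IsStandardGate (controlledA (Pi.mulSingle j
      (diagonal (Pi.mulSingle p x * Pi.mulSingle q y)))) := by
  have hV : controlledA (Pi.mulSingle 1 (diagonal ![x, y])) ∈ unitaryGroup (Fin 2 × Fin 2) ℂ := by
    refine controlledA_mem_unitaryGroup fun s => ?_
    fin_cases s
    exacts [one_mem _, hU]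
  refine ⟨basisFrame (Function.Embedding.embFinTwo hij),
    basisFrame (Function.Embedding.embFinTwo hpq),
    controlledA (Pi.mulSingle 1 (diagonal ![x, y])), basisFrame_conjTranspose_mul_self _,
    basisFrame_conjTranspose_mul_self _, hV,
    hasSchmidtRank_two_controlledA_mulSingle (linearIndependent_one_diagonal (i := 0) (j := 1) hxy),
    ?_⟩
  rw [extendGate_controlledA_mulSingle, extendByOne_basisFrame_diagonal]
  rfl

theorem cnotA_eq_controlledA : cnotA = controlledA (Pi.mulSingle 1 !![0, 1; 1, 0]) := by
  rw [controlledA_eq_sum, Fin.sum_univ_two, cnotA]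
  congr 2 <;> ext s t <;> fin_cases s <;> fin_cases t <;> simp

theorem isCNOTGate_controlledA_mulSingle_swap {i j : Fin dA} (hij : i ≠ j) {p q : Fin dB}
    (hpq : p ≠ q) : IsCNOTGate (controlledA (Pi.mulSingle j ((Equiv.swap p q).permMatrix ℂ))) := by
  refine ⟨Function.Embedding.embFinTwo hij, Function.Embedding.embFinTwo hpq, .inl ?_⟩
  rw [cnotA_eq_controlledA, extendGate_controlledA_mulSingle, extendByOne_basisFrame_swap]
  rfl

end SingleControl

section Diagonalization

variable {n : Type*} [Fintype n] [DecidableEq n]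

/-- The diagonal unitary with the given phases. -/
noncomputable def phaseMatrix : (n → Circle) →* Matrix n n ℂ :=
  (diagonalRingHom n ℂ : (n → ℂ) →* _).comp (Circle.coeHom.compLeft n)

theorem phaseMatrix_eq_diagonal (l : n → Circle) : phaseMatrix l = diagonal fun k => (l k : ℂ) :=
  rfl

theorem phaseMatrix_mem_unitaryGroup (l : n → Circle) : phaseMatrix l ∈ unitaryGroup n ℂ := by
  rw [mem_unitaryGroup_iff, star_eq_conjTranspose, phaseMatrix_eq_diagonal,
    diagonal_conjTranspose, diagonal_mul_diagonal, ← diagonal_one]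
  congr! 2 with k
  exact (Complex.mul_conj _).trans (by simp)

open scoped Matrix.Norms.L2Operator in
/-- The spectrum is finite, so that the discontinuity of the argument does no harm. -/
theorem exists_isHermitian_exp_eq {W : Matrix n n ℂ} (hW : W ∈ unitaryGroup n ℂ) :
    ∃ H : Matrix n n ℂ, H.IsHermitian ∧ NormedSpace.exp (Complex.I • H) = W := by
  have hcont (f : ℂ → ℂ) : ContinuousOn f (spectrum ℂ W) := W.finite_spectrum.continuousOn f
  have hexp : ∀ z ∈ spectrum ℂ W, NormedSpace.exp (Complex.I • (Complex.arg z : ℂ)) = z := by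
    intro z hz
    have hz : ‖z‖ = 1 := spectrum.norm_eq_one_of_unitary hW hz
    rw [← Complex.exp_eq_exp_ℂ, smul_eq_mul, mul_comm]
    simpa [hz] using Complex.norm_mul_exp_arg_mul_I z
  have hnormal : IsStarNormal W := isStarNormal_of_mem_unitary hW
  refine ⟨cfc (fun z => (Complex.arg z : ℂ)) W, IsSelfAdjoint.cfc_arg W, ?_⟩
  rw [← cfc_smul (hf := hcont _), ← CFC.exp_eq_normedSpace_exp (𝕜 := ℂ),
    ← cfc_comp' (hg := NormedSpace.exp_continuous.continuousOn) (hf := hcont _),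
    cfc_congr hexp, cfc_id' ..]

theorem exists_phaseMatrix_diagonalization {W : Matrix n n ℂ} (hW : W ∈ unitaryGroup n ℂ) :
    ∃ Y ∈ unitaryGroup n ℂ, ∃ l : n → Circle, W = Y * phaseMatrix l * Yᴴ := by
  obtain ⟨H, hH, rfl⟩ := exists_isHermitian_exp_eq hW
  obtain ⟨Y, hY, hdiag⟩ : ∃ Y ∈ unitaryGroup n ℂ,
      H = Y * diagonal (fun k => (hH.eigenvalues k : ℂ)) * Yᴴ :=
    ⟨_, hH.eigenvectorUnitary.2, hH.spectral_theorem⟩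
  have hunit : IsUnit Y := (Unitary.toUnits ⟨Y, hY⟩).isUnit
  have hinv : Yᴴ = Y⁻¹ := (inv_eq_right_inv (mem_unitaryGroup_iff.1 hY)).symm
  refine ⟨Y, hY, fun k => Circle.exp (hH.eigenvalues k), ?_⟩
  have hexp : phaseMatrix (fun k => Circle.exp (hH.eigenvalues k)) =
      NormedSpace.exp (Complex.I • diagonal fun k => (hH.eigenvalues k : ℂ)) := by
    rw [← diagonal_smul, exp_diagonal, phaseMatrix_eq_diagonal]
    congr 1
    ext k
    simp [← Complex.exp_eq_exp_ℂ, mul_comm]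
  rw [hexp, hinv, ← exp_conj _ _ hunit, ← hinv, mul_smul_comm,
    smul_mul_assoc, ← hdiag]

end Diagonalization

section StandardCount

variable {dA dB : ℕ} {i j : Fin dA}

theorem controlledA_mulSingle_conj {m n R : Type*} [Fintype m] [Fintype n] [DecidableEq m]
    [DecidableEq n] [CommSemiring R] (j : m) {Y Y' : Matrix n n R} (h : Y * Y' = 1)
    (D : Matrix n n R) : controlledA (Pi.mulSingle j (Y * D * Y')) =
      (1 ⊗ₖ Y) * controlledA (Pi.mulSingle j D) * (1 ⊗ₖ Y') := by
  rw [← controlledA_const, ← controlledA_const, ← map_mul, ← map_mul]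
  congr 1
  ext1 k
  obtain rfl | hk := eq_or_ne k j
  · simp
  · simp [hk, h]

theorem controlledA_mulSingle_phaseMatrix_const {m n : Type*} [Fintype m] [Fintype n]
    [DecidableEq m] [DecidableEq n] (j : m) (c : Circle) :
    controlledA (Pi.mulSingle j (phaseMatrix fun _ : n => c)) =
      phaseMatrix (Pi.mulSingle j c) ⊗ₖ 1 := by
  ext ⟨k, l⟩ ⟨k', l'⟩
  obtain rfl | hk := eq_or_ne k k'
  · obtain rfl | hj := eq_or_ne k j
    · simp [controlledA_apply, phaseMatrix_eq_diagonal, diagonal_apply, one_apply]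
    · simp [controlledA_apply, phaseMatrix_eq_diagonal, hj]
  · simp [controlledA_apply, phaseMatrix_eq_diagonal, hk]

theorem phaseMatrix_mulSingle {n : Type*} [Fintype n] [DecidableEq n] (p : n) (x : Circle) :
    phaseMatrix (Pi.mulSingle p x) = diagonal (Pi.mulSingle p (x : ℂ)) :=
  congrArg diagonal <| funext <|
    Pi.apply_mulSingle (fun _ => Circle.coeHom) (fun _ => map_one _) p x

theorem isStandardGate_controlledA_mulSingle_phaseMatrix (hij : i ≠ j) {p q : Fin dB}
    (hpq : p ≠ q) {x y : Circle} (hxy : x ≠ y) :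
    IsStandardGate (controlledA (Pi.mulSingle j
      (phaseMatrix (Pi.mulSingle p x * Pi.mulSingle q y)))) := by
  have hdiag : phaseMatrix (Pi.mulSingle p x * Pi.mulSingle q y) =
      diagonal (Pi.mulSingle p (x : ℂ) * Pi.mulSingle q (y : ℂ)) := by
    rw [map_mul, phaseMatrix_mulSingle, phaseMatrix_mulSingle, diagonal_mul_diagonal]
    rfl
  rw [hdiag]
  refine isStandardGate_controlledA_mulSingle_diagonal hij hpq (Circle.coe_injective.ne hxy) ?_
  convert phaseMatrix_mem_unitaryGroup ![x, y]
  ext s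
  fin_cases s <;> rfl

/-- Pairing distinct phases as long as possible leaves a constant family, which a global phase
makes trivial. -/
theorem exists_isProductOfAtMost_phaseMatrix (hij : i ≠ j) (l : Fin dB → Circle)
    (s : Finset (Fin dB)) :
    ∃ c, IsProductOfAtMost IsStandardGate (localUnitaries dA dB) (s.card / 2)
      (controlledA (Pi.mulSingle j (phaseMatrix fun k => if k ∈ s then c * l k else 1))) := by
  induction s using Finset.strongInduction with
  | H s ih =>
    by_cases hconst : ∃ c, ∀ k ∈ s, c * l k = 1
    · obtain ⟨c, hc⟩ := hconst
      have hone : (fun k => if k ∈ s then c * l k else 1) = 1 :=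
        funext fun k => ite_eq_right_iff.2 (hc k)
      refine ⟨c, ?_⟩
      rw [hone, map_one, Pi.mulSingle_one, map_one]
      exact .of_mem (one_mem _)
    · obtain ⟨p, hp⟩ : s.Nonempty := by
        by_contra! rfl
        exact hconst ⟨1, by simp⟩
      obtain ⟨q, hqs, hl⟩ : ∃ q ∈ s, (l p)⁻¹ * l q ≠ 1 := by
        by_contra! hc
        exact hconst ⟨_, hc⟩
      rw [Ne, inv_mul_eq_one] at hl
      have hpq : p ≠ q := fun h => hl (congrArg l h)
      have hq : q ∈ s.erase p := Finset.mem_erase.2 ⟨hpq.symm, hqs⟩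
      obtain ⟨c, hc⟩ := ih ((s.erase p).erase q)
        ((Finset.erase_subset _ _).trans_ssubset (Finset.erase_ssubset hp))
      have hcard : s.card / 2 = 1 + ((s.erase p).erase q).card / 2 := by
        have := Finset.card_erase_add_one hp
        have := Finset.card_erase_add_one hq
        lia
      have hsplit : (fun k => if k ∈ s then c * l k else 1) =
          (Pi.mulSingle p (c * l p) * Pi.mulSingle q (c * l q)) *
            fun k => if k ∈ (s.erase p).erase q then c * l k else 1 := by
        ext1 k
        obtain rfl | hkp := eq_or_ne k p
        · simp [hp, hpq]
        · obtain rfl | hkq := eq_or_ne k q <;> simp_all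
      refine ⟨c, ?_⟩
      rw [hsplit, map_mul, Pi.mulSingle_mul, map_mul, hcard]
      exact (IsProductOfAtMost.of_gate (isStandardGate_controlledA_mulSingle_phaseMatrix hij hpq
        (by simpa using hl))).mul hc

theorem isProductOfAtMost_controlledA_mulSingle (hij : i ≠ j) {W : Matrix (Fin dB) (Fin dB) ℂ}
    (hW : W ∈ unitaryGroup (Fin dB) ℂ) :
    IsProductOfAtMost IsStandardGate (localUnitaries dA dB) (dB / 2)
      (controlledA (Pi.mulSingle j W)) := by
  obtain ⟨Y, hY, l, rfl⟩ := exists_phaseMatrix_diagonalization hW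
  obtain ⟨c, hc⟩ := exists_isProductOfAtMost_phaseMatrix hij l Finset.univ
  have hl : l = (fun _ => c⁻¹) * fun k => if k ∈ Finset.univ then c * l k else 1 := by
    ext1 k
    simp
  rw [Finset.card_fin] at hc
  rw [controlledA_mulSingle_conj j (Y' := Yᴴ) (mem_unitaryGroup_iff.1 hY), hl, map_mul,
    Pi.mulSingle_mul, map_mul, controlledA_mulSingle_phaseMatrix_const]
  exact .mul_local (one_kronecker_mem_localUnitaries (Unitary.star_mem hY)) <|
    .local_mul (one_kronecker_mem_localUnitaries hY) <|
    .local_mul (kronecker_one_mem_localUnitaries (phaseMatrix_mem_unitaryGroup _)) hc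

theorem isProductOfAtMost_controlledA {W : Fin dA → Matrix (Fin dB) (Fin dB) ℂ}
    (hW : ∀ i, W i ∈ unitaryGroup (Fin dB) ℂ) :
    IsProductOfAtMost IsStandardGate (localUnitaries dA dB) ((dA - 1) * (dB / 2))
      (controlledA W) :=
  IsProductOfAtMost.controlledA_of_mulSingle (φ := (unitaryGroup (Fin dB) ℂ).subtype)
    (fun g => one_kronecker_mem_localUnitaries g.2)
    (fun _ _ hij g => isProductOfAtMost_controlledA_mulSingle hij g.2) fun i => ⟨W i, hW i⟩

theorem isProductOfAtMost_controlledB {V : Fin dB → Matrix (Fin dA) (Fin dA) ℂ}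
    (hV : ∀ j, V j ∈ unitaryGroup (Fin dA) ℂ) :
    IsProductOfAtMost IsStandardGate (localUnitaries dA dB) ((dB - 1) * (dA / 2))
      (controlledB V) :=
  (isProductOfAtMost_controlledA hV).swapParties IsStandardGate.swapParties
    swapParties_mem_localUnitaries

end StandardCount

section CNOTCount

theorem exists_isSwap_list_prod_eq {α : Type*} [Fintype α] [DecidableEq α] (σ : Equiv.Perm α) :
    ∃ l : List (Equiv.Perm α),
      (∀ τ ∈ l, τ.IsSwap) ∧ l.length ≤ σ.support.card - 1 ∧ l.prod = σ := by
  induction h : σ.support.card using Nat.strong_induction_on generalizing σ with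
  | h k ih =>
    obtain rfl | hσ := eq_or_ne σ 1
    · exact ⟨[], by simp⟩
    · obtain ⟨x, hx⟩ : ∃ x, σ x ≠ x := by
        by_contra! hfix
        exact hσ (Equiv.ext hfix)
      have hlt := Equiv.Perm.card_support_swap_mul hx
      have htwo := Equiv.Perm.two_le_card_support_of_ne_one hσ
      obtain ⟨l, hl, hlen, hprod⟩ := ih _ (h ▸ hlt) _ rfl
      refine ⟨Equiv.swap x (σ x) :: l, List.forall_mem_cons.2 ⟨⟨x, σ x, hx.symm, rfl⟩, hl⟩, ?_, ?_⟩
      · rw [List.length_cons]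
        lia
      · rw [List.prod_cons, hprod, Equiv.swap_mul_self_mul]

variable {dA dB : ℕ}

theorem isProductOfAtMost_controlledA_mulSingle_permMatrixHom {i j : Fin dA} (hij : i ≠ j)
    (σ : Equiv.Perm (Fin dB)) :
    IsProductOfAtMost IsCNOTGate (localPermutations dA dB) (dB - 1)
      (controlledA (Pi.mulSingle j (permMatrixHom (R := ℂ) σ))) := by
  obtain ⟨l, hl, hlen, rfl⟩ := exists_isSwap_list_prod_eq σ
  let Φ : Equiv.Perm (Fin dB) →* BipartiteMatrix dA dB :=
    (controlledA : _ →+* BipartiteMatrix dA dB).toMonoidHom.comp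
      ((MonoidHom.mulSingle _ j).comp (permMatrixHom (R := ℂ)))
  have hgate : ∀ U ∈ l.map Φ, IsProductOfAtMost IsCNOTGate (localPermutations dA dB) 1 U := by
    intro U hU
    obtain ⟨τ, hτ, rfl⟩ := List.mem_map.1 hU
    obtain ⟨p, q, hpq, rfl⟩ := hl τ hτ
    refine .of_gate ?_
    convert isCNOTGate_controlledA_mulSingle_swap hij hpq using 3
    simp [Φ]
  have hcard : l.length ≤ dB - 1 :=
    hlen.trans (Nat.sub_le_sub_right ((Finset.card_le_univ _).trans_eq (Fintype.card_fin dB)) 1)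
  change IsProductOfAtMost _ _ _ (Φ l.prod)
  rw [map_list_prod]
  exact (IsProductOfAtMost.list_prod hgate).mono (by simpa using hcard)

theorem isProductOfAtMost_controlledA_permMatrix (σ : Fin dA → Equiv.Perm (Fin dB)) :
    IsProductOfAtMost IsCNOTGate (localPermutations dA dB) ((dA - 1) * (dB - 1))
      (controlledA fun i => (σ i).permMatrix ℂ) := by
  have h := IsProductOfAtMost.controlledA_of_mulSingle (φ := permMatrixHom (R := ℂ))
    (loc := localPermutations dA dB)
    (fun g => ⟨1, g⁻¹, by simp⟩)
    (fun i j hij g => isProductOfAtMost_controlledA_mulSingle_permMatrixHom hij g) σ⁻¹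
  simpa using h

theorem isProductOfAtMost_controlledB_permMatrix (τ : Fin dB → Equiv.Perm (Fin dA)) :
    IsProductOfAtMost IsCNOTGate (localPermutations dA dB) ((dB - 1) * (dA - 1))
      (controlledB fun j => (τ j).permMatrix ℂ) :=
  (isProductOfAtMost_controlledA_permMatrix τ).swapParties IsCNOTGate.swapParties
    swapParties_mem_localPermutations

end CNOTCount

section EdgeColoring

open Finset Function

variable {E V : Type*} {n : ℕ}

open scoped Classical in
/-- The colouring that extends `c` by giving a new colour to the edges `m v`, used to add a perfect
matching to an edge-coloured multigraph. -/
noncomputable def extendColoring (m : V → E) (c : {e // e ∉ Set.range m} → Fin n) (e : E) :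
    Fin (n + 1) :=
  if he : e ∉ Set.range m then (c ⟨e, he⟩).castSucc else Fin.last n

theorem injective_prodMk_extendColoring {k : E → V} {m : V → E} (hk : Injective (k ∘ m))
    {c : {e // e ∉ Set.range m} → Fin n}
    (hc : Injective fun e : {e // e ∉ Set.range m} => (k e, c e)) :
    Injective fun e => (k e, extendColoring m c e) := by
  have hrest (e : {e // e ∉ Set.range m}) : extendColoring m c e = (c e).castSucc := dif_pos e.2
  have hne (e : {e // e ∉ Set.range m}) (v : V) :
      extendColoring m c e ≠ extendColoring m c (m v) := by
    rw [hrest, extendColoring, dif_neg (by simp)]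
    exact Fin.castSucc_ne_last _
  intro e₁ e₂ h
  obtain ⟨hk', hc'⟩ := Prod.ext_iff.1 h
  by_cases h₁ : e₁ ∈ Set.range m <;> by_cases h₂ : e₂ ∈ Set.range m
  · obtain ⟨v₁, rfl⟩ := h₁
    obtain ⟨v₂, rfl⟩ := h₂
    exact congrArg m (hk hk')
  · obtain ⟨v, rfl⟩ := h₁
    exact absurd hc'.symm (hne ⟨e₂, h₂⟩ v)
  · obtain ⟨v, rfl⟩ := h₂
    exact absurd hc' (hne ⟨e₁, h₁⟩ v)
  · lift e₁ to {e // e ∉ Set.range m} using h₁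
    lift e₂ to {e // e ∉ Set.range m} using h₂
    dsimp only at hc'
    rw [hrest, hrest] at hc'
    exact congrArg Subtype.val (hc (Prod.ext hk' (Fin.castSucc_injective n hc')))

variable [Fintype E] [DecidableEq V] {f g : E → V}

/-- A bipartite multigraph on two copies of `V` is encoded by its type `E` of edges and by the maps
`f` and `g` to their endpoints. -/
theorem exists_perfect_matching_of_regular [Finite V] (hn : 0 < n) (hf : ∀ v, #{e | f e = v} = n)
    (hg : ∀ v, #{e | g e = v} = n) :
    ∃ m : V → E, f ∘ m = id ∧ Bijective (g ∘ m) := by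
  cases nonempty_fintype V
  have hcount (k : E → V) (hk : ∀ v, #{e | k e = v} = n) (S : Finset V) :
      #{e | k e ∈ S} = #S * n := by
    rw [← sum_card_fiberwise_eq_card_filter, sum_congr rfl fun v _ => hk v, sum_const, smul_eq_mul]
  have hall (S : Finset V) : #S ≤ #(S.biUnion fun v => image g {e | f e = v}) := by
    refine Nat.le_of_mul_le_mul_right ?_ hn
    rw [← hcount f hf, ← hcount g hg]
    refine card_le_card fun e he => ?_
    rw [mem_filter_univ] at he ⊢
    exact mem_biUnion.2 ⟨f e, he, mem_image_of_mem g (by simp)⟩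
  obtain ⟨h, hinj, hmem⟩ := (all_card_le_biUnion_card_iff_exists_injective _).1 hall
  have hedge (v : V) : ∃ e, f e = v ∧ g e = h v := by simpa using hmem v
  choose m hfm hgm using hedge
  obtain rfl : g ∘ m = h := funext hgm
  exact ⟨m, funext hfm, Finite.injective_iff_bijective.1 hinj⟩

open scoped Classical in
theorem card_fiber_compl_range {k : E → V} {m : V → E} (h : Bijective (k ∘ m)) (v : V) :
    #{e : {e // e ∉ Set.range m} | k e = v} = #{e | k e = v} - 1 := by
  obtain ⟨u, rfl⟩ := h.surjective v
  rw [← card_erase_of_mem (show m u ∈ ({e | k e = (k ∘ m) u} : Finset E) by simp),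
    ← card_map (Embedding.subtype _)]
  congr 1
  ext e
  simp only [mem_map, mem_filter_univ, mem_erase, Embedding.subtype_apply]
  constructor
  · rintro ⟨⟨e, he⟩, hk, rfl⟩
    exact ⟨fun hu => he ⟨u, hu.symm⟩, hk⟩
  · rintro ⟨hu, hk⟩
    refine ⟨⟨e, ?_⟩, hk, rfl⟩
    rintro ⟨w, rfl⟩
    exact hu (congrArg m (h.injective hk))

theorem exists_edge_coloring_of_regular [Finite V] (hf : ∀ v, #{e | f e = v} = n)
    (hg : ∀ v, #{e | g e = v} = n) :
    ∃ c : E → Fin n, Injective (fun e => (f e, c e)) ∧ Injective (fun e => (g e, c e)) := by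
  classical
  induction n generalizing E with
  | zero =>
    have hE : IsEmpty E := ⟨fun e => notMem_empty e (card_eq_zero.1 (hf (f e)) ▸ by simp)⟩
    exact ⟨isEmptyElim, injective_of_subsingleton _, injective_of_subsingleton _⟩
  | succ n ih =>
    obtain ⟨m, hfm, hgm⟩ := exists_perfect_matching_of_regular n.succ_pos hf hg
    have hfm : Bijective (f ∘ m) := hfm ▸ bijective_id
    obtain ⟨c, hfc, hgc⟩ := ih (E := {e // e ∉ Set.range m}) (f := fun e => f e) (g := fun e => g e)
      (fun v => by rw [card_fiber_compl_range hfm, hf, Nat.add_sub_cancel])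
      (fun v => by rw [card_fiber_compl_range hgm, hg, Nat.add_sub_cancel])
    exact ⟨extendColoring m c, injective_prodMk_extendColoring hfm.injective hfc,
      injective_prodMk_extendColoring hgm.injective hgc⟩

end EdgeColoring

section Grid

variable {m n : Type*}

theorem exists_prodCongrRight_eq [Finite n] {π : Equiv.Perm (m × n)} (h : ∀ x, (π x).1 = x.1) :
    ∃ α : m → Equiv.Perm n, Equiv.prodCongrRight α = π := by
  have hinj (a : m) : Function.Injective fun b => (π (a, b)).2 := fun b b' hb =>
    congrArg Prod.snd (π.injective (Prod.ext ((h (a, b)).trans (h (a, b')).symm) hb))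
  exact ⟨fun a => Equiv.ofBijective _ (Finite.injective_iff_bijective.1 (hinj a)),
    Equiv.ext fun x => Prod.ext (h x).symm rfl⟩

theorem exists_prodCongrLeft_eq [Finite m] {π : Equiv.Perm (m × n)} (h : ∀ x, (π x).2 = x.2) :
    ∃ β : n → Equiv.Perm m, Equiv.prodCongrLeft β = π := by
  have hinj (b : n) : Function.Injective fun a => (π (a, b)).1 := fun a a' ha =>
    congrArg Prod.fst (π.injective (Prod.ext ha ((h (a, b)).trans (h (a', b)).symm)))
  exact ⟨fun b => Equiv.ofBijective _ (Finite.injective_iff_bijective.1 (hinj b)),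
    Equiv.ext fun x => Prod.ext rfl (h x).symm⟩

/-- The cells `e` are the edges of the regular bipartite multigraph that joins the row of `e` to the
row of `σ e`. The column in which `e` changes rows is its colour. -/
theorem exists_row_column_row_decomposition [Finite m] [Finite n] (σ : Equiv.Perm (m × n)) :
    ∃ (α : m → Equiv.Perm n) (β : n → Equiv.Perm m) (γ : m → Equiv.Perm n),
      σ = Equiv.prodCongrRight γ * Equiv.prodCongrLeft β * Equiv.prodCongrRight α := by
  classical
  cases nonempty_fintype m
  cases nonempty_fintype n
  have hrow (a : m) : Finset.card {e : m × n | e.1 = a} = Fintype.card n := by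
    have hfiber : (Finset.univ.filter fun e : m × n => e.1 = a) = {a} ×ˢ Finset.univ := by
      ext ⟨x, y⟩
      simp [eq_comm]
    rw [hfiber, Finset.card_product, Finset.card_singleton, one_mul, Finset.card_univ]
  have hrow' (a : m) : Finset.card {e : m × n | (σ e).1 = a} = Fintype.card n :=
    (Finset.card_equiv σ (by simp)).trans (hrow a)
  obtain ⟨c, hc, hσc⟩ := exists_edge_coloring_of_regular hrow hrow'
  let column (e : m × n) : n := (Fintype.equivFin n).symm (c e)
  have hbij (k : m × n → m) (hk : Function.Injective fun e => (k e, c e)) :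
      Function.Bijective fun e => (k e, column e) :=
    Finite.injective_iff_bijective.1 <|
      (Function.Injective.prodMap Function.injective_id (Fintype.equivFin n).symm.injective).comp hk
  let R : Equiv.Perm (m × n) := Equiv.ofBijective _ (hbij _ hc)
  let C : Equiv.Perm (m × n) := Equiv.ofBijective _ (hbij _ hσc)
  obtain ⟨α, hα⟩ := exists_prodCongrRight_eq (π := R) fun e => rfl
  obtain ⟨β, hβ⟩ := exists_prodCongrLeft_eq (π := C * R⁻¹) (R.surjective.forall.2 fun e => by
    simp [R, C])
  obtain ⟨γ, hγ⟩ := exists_prodCongrRight_eq (π := σ * C⁻¹) (C.surjective.forall.2 fun e => by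
    simp [C])
  exact ⟨α, β, γ, by rw [hα, hβ, hγ]; group⟩

end Grid

section Permutations

theorem permMatrix_mem_unitaryGroup {n R : Type*} [Fintype n] [DecidableEq n] [CommRing R]
    [StarRing R] (σ : Equiv.Perm n) : σ.permMatrix R ∈ unitaryGroup n R := by
  rw [mem_unitaryGroup_iff, star_eq_conjTranspose, conjTranspose_permMatrix, ← permMatrix_mul]
  simp

theorem exists_permMatrix_eq_controlledA_mul_controlledB_mul_controlledA {m n R : Type*}
    [Fintype m] [Fintype n] [DecidableEq m] [DecidableEq n] [CommSemiring R]
    (σ : Equiv.Perm (m × n)) :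
    ∃ (α : m → Equiv.Perm n) (β : n → Equiv.Perm m) (γ : m → Equiv.Perm n),
      σ.permMatrix R = controlledA (fun i => (α i).permMatrix R) *
        controlledB (fun j => (β j).permMatrix R) * controlledA fun i => (γ i).permMatrix R := by
  obtain ⟨α, β, γ, rfl⟩ := exists_row_column_row_decomposition σ
  refine ⟨α, β, γ, ?_⟩
  rw [permMatrix_mul, permMatrix_mul, controlledA_permMatrix, controlledA_permMatrix,
    controlledB_permMatrix, mul_assoc]

theorem exists_eq_phaseMatrix {n : Type*} [Fintype n] [DecidableEq n] {d : n → ℂ}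
    (h : diagonal d ∈ unitaryGroup n ℂ) : ∃ l, diagonal d = phaseMatrix l := by
  rw [mem_unitaryGroup_iff, star_eq_conjTranspose, diagonal_conjTranspose,
    diagonal_mul_diagonal, ← diagonal_one, diagonal_eq_diagonal_iff] at h
  have hd (k : n) : d k ∈ unitary ℂ := Unitary.mem_iff_self_mul_star.2 (h k)
  exact ⟨fun k => ⟨d k, mem_sphere_zero_iff_norm.2 (CStarRing.norm_of_mem_unitary (hd k))⟩, rfl⟩

theorem exists_eq_phaseMatrix_mul_permMatrix {n : Type*} [Fintype n] [DecidableEq n]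
    {U : Matrix n n ℂ} (hU : U ∈ unitaryGroup n ℂ) (hrow : ∀ i, ∃! j, U i j ≠ 0)
    (hcol : ∀ j, ∃! i, U i j ≠ 0) :
    ∃ (l : n → Circle) (σ : Equiv.Perm n), U = phaseMatrix l * σ.permMatrix ℂ := by
  choose f hf hf' using hrow
  have hinj : Function.Injective f := fun i i' h =>
    (hcol (f i)).unique (hf i) (h ▸ hf i')
  let σ : Equiv.Perm n := Equiv.ofBijective f (Finite.injective_iff_bijective.1 hinj)
  have hUσ : U = diagonal (fun i => U i (σ i)) * σ.permMatrix ℂ := by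
    ext i j
    rw [diagonal_mul, Equiv.Perm.permMatrix, PEquiv.toMatrix_toPEquiv_apply]
    obtain rfl | h := eq_or_ne (σ i) j
    · simp
    · have hzero : U i j = 0 := by
        by_contra h0
        exact h (hf' i j h0).symm
      simp [hzero, h]
  have hdiag : diagonal (fun i => U i (σ i)) = U * star (σ.permMatrix ℂ) := by
    nth_rw 2 [hUσ]
    rw [mul_assoc, Unitary.mul_star_self_of_mem (permMatrix_mem_unitaryGroup σ), mul_one]
  obtain ⟨l, hl⟩ := exists_eq_phaseMatrix <|
    hdiag ▸ mul_mem hU (Unitary.star_mem (permMatrix_mem_unitaryGroup σ))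
  exact ⟨l, σ, hl ▸ hUσ⟩

variable {dA dB : ℕ}

theorem IsComplexPermutation.isProductOfAtMost {U : BipartiteMatrix dA dB}
    (hU : IsComplexPermutation U) :
    IsProductOfAtMost IsStandardGate (localUnitaries dA dB)
      (2 * (dA - 1) * (dB / 2) + (dB - 1) * (dA / 2)) U := by
  obtain ⟨l, σ, rfl⟩ := exists_eq_phaseMatrix_mul_permMatrix hU.1 hU.2.1 hU.2.2
  obtain ⟨α, β, γ, h⟩ :=
    exists_permMatrix_eq_controlledA_mul_controlledB_mul_controlledA (R := ℂ) σ
  have hphase : phaseMatrix l = controlledA fun i => phaseMatrix fun j => l (i, j) :=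
    (controlledA_diagonal fun x => (l x : ℂ)).symm
  rw [h, hphase, ← mul_assoc, ← mul_assoc, ← map_mul]
  refine (((isProductOfAtMost_controlledA fun i => ?_).mul
    (isProductOfAtMost_controlledB fun j => permMatrix_mem_unitaryGroup (β j))).mul
    (isProductOfAtMost_controlledA fun i => permMatrix_mem_unitaryGroup (γ i))).mono (by lia)
  exact mul_mem (phaseMatrix_mem_unitaryGroup _) (permMatrix_mem_unitaryGroup _)

theorem isProductOfAtMost_permMatrix (σ : Equiv.Perm (Fin dA × Fin dB)) :
    IsProductOfAtMost IsCNOTGate (localPermutations dA dB) (3 * (dA - 1) * (dB - 1))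
      (σ.permMatrix ℂ) := by
  obtain ⟨α, β, γ, h⟩ :=
    exists_permMatrix_eq_controlledA_mul_controlledB_mul_controlledA (R := ℂ) σ
  rw [h]
  exact (((isProductOfAtMost_controlledA_permMatrix α).mul
    (isProductOfAtMost_controlledB_permMatrix β)).mul
    (isProductOfAtMost_controlledA_permMatrix γ)).mono (by ring_nf; rfl)

end Permutations

section GramMatrix

variable {𝕜 : Type*} [RCLike 𝕜]

theorem exists_linearIsometry_apply_eq {V E : Type*} [AddCommGroup V] [Module 𝕜 V]
    [NormedAddCommGroup E] [InnerProductSpace 𝕜 E] [FiniteDimensional 𝕜 E] {f g : V →ₗ[𝕜] E}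
    (h : ∀ x, ‖f x‖ = ‖g x‖) : ∃ L : E →ₗᵢ[𝕜] E, ∀ x, L (g x) = f x := by
  obtain ⟨s, hs⟩ := g.rangeRestrict.exists_rightInverse_of_surjective g.range_rangeRestrict
  have hgs (y : LinearMap.range g) : g (s y) = y :=
    congrArg Subtype.val (LinearMap.congr_fun hs y)
  let T : LinearMap.range g →ₗᵢ[𝕜] E :=
    ⟨f ∘ₗ s, fun y => by rw [LinearMap.comp_apply, h, hgs, Submodule.coe_norm]⟩
  refine ⟨T.extend, fun x => (T.extend_apply (g.rangeRestrict x)).trans ?_⟩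
  change f (s (g.rangeRestrict x)) = f x
  have hker : g (s (g.rangeRestrict x) - x) = 0 := by
    rw [map_sub, hgs]
    exact sub_self (g x)
  rw [← sub_eq_zero, ← map_sub, ← norm_eq_zero, h, hker, norm_zero]

variable {p q : Type*} [Fintype p]

theorem norm_toEuclideanLin_eq_of_conjTranspose_mul_self_eq [Fintype q] [DecidableEq q]
    {A B : Matrix p q 𝕜} (h : Aᴴ * A = Bᴴ * B) (x : EuclideanSpace 𝕜 q) :
    ‖toEuclideanLin A x‖ = ‖toEuclideanLin B x‖ := by
  classical
  have hinner (M : Matrix p q 𝕜) : inner 𝕜 (toEuclideanLin M x) (toEuclideanLin M x) =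
      inner 𝕜 x (toEuclideanLin (Mᴴ * M) x) := by
    rw [toLpLin_mul_same, toEuclideanLin_conjTranspose_eq_adjoint, LinearMap.comp_apply,
      LinearMap.adjoint_inner_right]
  rw [norm_eq_sqrt_re_inner (𝕜 := 𝕜), norm_eq_sqrt_re_inner (𝕜 := 𝕜), hinner, hinner, h]

theorem exists_mem_unitaryGroup_toEuclideanLin_eq [DecidableEq p]
    (L : EuclideanSpace 𝕜 p →ₗᵢ[𝕜] EuclideanSpace 𝕜 p) :
    ∃ W ∈ unitaryGroup p 𝕜, toEuclideanLin W = L.toLinearMap :=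
  ⟨toEuclideanLin.symm L.toLinearMap,
    (L.toLinearIsometryEquiv rfl).toMatrix_mem_unitaryGroup (EuclideanSpace.basisFun p 𝕜)
      (EuclideanSpace.basisFun p 𝕜), LinearEquiv.apply_symm_apply _ _⟩

theorem exists_mem_unitaryGroup_eq_mul_of_conjTranspose_mul_self_eq [Finite q] [DecidableEq p]
    {A B : Matrix p q 𝕜} (h : Aᴴ * A = Bᴴ * B) : ∃ W ∈ unitaryGroup p 𝕜, A = W * B := by
  classical
  cases nonempty_fintype q
  obtain ⟨L, hL⟩ :=
    exists_linearIsometry_apply_eq (norm_toEuclideanLin_eq_of_conjTranspose_mul_self_eq h)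
  obtain ⟨W, hW, hWL⟩ := exists_mem_unitaryGroup_toEuclideanLin_eq L
  refine ⟨W, hW, toEuclideanLin.injective ?_⟩
  rw [toLpLin_mul_same, hWL]
  exact LinearMap.ext fun x => (hL x).symm

open scoped ComplexOrder in
theorem exists_singular_value_decomposition [DecidableEq p] (X : Matrix p p 𝕜) :
    ∃ Y ∈ unitaryGroup p 𝕜, ∃ Z ∈ unitaryGroup p 𝕜, ∃ c : p → ℝ,
      X = Y * diagonal (fun j => (c j : 𝕜)) * Z := by
  have hpos : (Xᴴ * X).PosSemidef := posSemidef_conjTranspose_mul_self X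
  obtain ⟨V, hV, hdiag⟩ : ∃ V ∈ unitaryGroup p 𝕜,
      Vᴴ * (Xᴴ * X) * V = diagonal fun j => (hpos.isHermitian.eigenvalues j : 𝕜) :=
    ⟨_, hpos.isHermitian.eigenvectorUnitary.2, by
      simpa [star_eq_conjTranspose, Function.comp_def] using
        hpos.isHermitian.conjStarAlgAut_star_eigenvectorUnitary⟩
  let c (j : p) : ℝ := √(hpos.isHermitian.eigenvalues j)
  have hgram : (X * V)ᴴ * (X * V) =
      (diagonal fun j => (c j : 𝕜))ᴴ * diagonal fun j => (c j : 𝕜) := by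
    rw [conjTranspose_mul, diagonal_conjTranspose, diagonal_mul_diagonal, mul_assoc,
      ← mul_assoc Xᴴ, ← mul_assoc, hdiag]
    congr! 2 with j
    simp [c, ← RCLike.ofReal_mul, Real.mul_self_sqrt (hpos.eigenvalues_nonneg j)]
  obtain ⟨Y, hY, hXY⟩ := exists_mem_unitaryGroup_eq_mul_of_conjTranspose_mul_self_eq hgram
  refine ⟨Y, hY, Vᴴ, Unitary.star_mem hV, c, ?_⟩
  rw [← hXY, mul_assoc, ← star_eq_conjTranspose, Unitary.mul_star_self_of_mem hV, mul_one]

end GramMatrix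

section CosineSine

variable {p q : Type*} [Fintype p] [Fintype q] [DecidableEq q]

theorem mul_fromRows_zero_one {R : Type*} [Ring R] (N : Matrix (p ⊕ q) (p ⊕ q) R) :
    N * fromRows (0 : Matrix p q R) (1 : Matrix q q R) =
      fromRows N.toBlocks₁₂ N.toBlocks₂₂ := by
  nth_rw 1 [← fromBlocks_toBlocks N]
  rw [fromBlocks_mul_fromRows]
  simp

variable [DecidableEq p]

section CommRing

variable {R : Type*} [CommRing R] [StarRing R]

theorem fromBlocks_mem_unitaryGroup {W : Matrix p p R} {Y : Matrix q q R}
    (hW : W ∈ unitaryGroup p R) (hY : Y ∈ unitaryGroup q R) :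
    fromBlocks W 0 0 Y ∈ unitaryGroup (p ⊕ q) R := by
  rw [mem_unitaryGroup_iff, star_eq_conjTranspose] at *
  simp [fromBlocks_conjTranspose, fromBlocks_multiply, hW, hY]

theorem conjTranspose_mul_self_toBlocks₁₂ {U : Matrix (p ⊕ q) (p ⊕ q) R}
    (hU : U ∈ unitaryGroup (p ⊕ q) R) :
    U.toBlocks₁₂ᴴ * U.toBlocks₁₂ = 1 - U.toBlocks₂₂ᴴ * U.toBlocks₂₂ := by
  rw [mem_unitaryGroup_iff', star_eq_conjTranspose, ← fromBlocks_toBlocks U,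
    fromBlocks_conjTranspose, fromBlocks_multiply, ← fromBlocks_one, fromBlocks_inj] at hU
  exact eq_sub_of_add_eq hU.2.2.2

theorem exists_eq_fromBlocks_of_mul_fromRows_eq {N : Matrix (p ⊕ q) (p ⊕ q) R}
    (hN : N ∈ unitaryGroup (p ⊕ q) R)
    (h : N * fromRows (0 : Matrix p q R) (1 : Matrix q q R) = fromRows 0 1) :
    ∃ V ∈ unitaryGroup p R, N = fromBlocks V 0 0 1 := by
  obtain ⟨h₁₂, h₂₂⟩ := fromRows_inj ((mul_fromRows_zero_one N).symm.trans h)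
  have hblocks : N = fromBlocks N.toBlocks₁₁ 0 N.toBlocks₂₁ 1 := by
    rw [← h₁₂, ← h₂₂, fromBlocks_toBlocks]
  have hgram := mem_unitaryGroup_iff'.1 hN
  rw [hblocks, star_eq_conjTranspose, fromBlocks_conjTranspose, fromBlocks_multiply,
    ← fromBlocks_one, fromBlocks_inj] at hgram
  have h₂₁ : N.toBlocks₂₁ = 0 := by simpa using hgram.2.2.1
  have h₁₁ : N.toBlocks₁₁ᴴ * N.toBlocks₁₁ = 1 := by simpa [h₂₁] using hgram.1
  exact ⟨N.toBlocks₁₁, mem_unitaryGroup_iff'.2 h₁₁, h₂₁ ▸ hblocks⟩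

end CommRing

variable {𝕜 : Type*} [RCLike 𝕜]

theorem exists_eq_fromBlocks_mul_mul_fromBlocks_of_toBlocks₂₂_eq {U M : Matrix (p ⊕ q) (p ⊕ q) 𝕜}
    (hU : U ∈ unitaryGroup (p ⊕ q) 𝕜) (hM : M ∈ unitaryGroup (p ⊕ q) 𝕜)
    (h : U.toBlocks₂₂ = M.toBlocks₂₂) :
    ∃ W ∈ unitaryGroup p 𝕜, ∃ V ∈ unitaryGroup p 𝕜,
      U = fromBlocks W 0 0 1 * M * fromBlocks V 0 0 1 := by
  obtain ⟨W, hW, hUM⟩ := exists_mem_unitaryGroup_eq_mul_of_conjTranspose_mul_self_eq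
    (A := U.toBlocks₁₂) (B := M.toBlocks₁₂)
    (by rw [conjTranspose_mul_self_toBlocks₁₂ hU, conjTranspose_mul_self_toBlocks₁₂ hM, h])
  have hWM : fromBlocks W 0 0 1 * M ∈ unitaryGroup (p ⊕ q) 𝕜 :=
    mul_mem (fromBlocks_mem_unitaryGroup hW (one_mem _)) hM
  have hcol : U * fromRows (0 : Matrix p q 𝕜) (1 : Matrix q q 𝕜) =
      fromBlocks W 0 0 1 * M * fromRows (0 : Matrix p q 𝕜) (1 : Matrix q q 𝕜) := by
    rw [Matrix.mul_assoc, mul_fromRows_zero_one, mul_fromRows_zero_one, fromBlocks_mul_fromRows,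
      hUM, h]
    simp
  obtain ⟨V, hV, hN⟩ := exists_eq_fromBlocks_of_mul_fromRows_eq
    (mul_mem (Unitary.star_mem hWM) hU) (by
      rw [Matrix.mul_assoc, hcol, ← Matrix.mul_assoc, Unitary.star_mul_self_of_mem hWM,
        Matrix.one_mul])
  exact ⟨W, hW, V, hV, by rw [← hN, ← mul_assoc, Unitary.mul_star_self_of_mem hWM, one_mul]⟩

/-- The columns with the entries `√(1 - c j ^ 2)` at `e j` and `c j` at `j` are orthonormal, hence
they are the last columns of a unitary. -/
theorem exists_mem_unitaryGroup_toBlocks₂₂_eq_diagonal (e : q ↪ p) {c : q → ℝ}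
    (hc : ∀ j, |c j| ≤ 1) :
    ∃ V ∈ unitaryGroup (p ⊕ q) 𝕜, V.toBlocks₂₂ = diagonal fun j => (c j : 𝕜) := by
  let S : Matrix p q 𝕜 := of fun i j => if i = e j then (√(1 - c j ^ 2) : 𝕜) else 0
  have hS : Sᴴ * S = diagonal fun j => (1 - c j ^ 2 : 𝕜) := by
    ext j k
    obtain rfl | hjk := eq_or_ne j k
    · have hpos : 0 ≤ 1 - c j ^ 2 := sub_nonneg.2 ((sq_le_one_iff_abs_le_one _).2 (hc j))
      simp [S, mul_apply, apply_ite, ← RCLike.ofReal_mul, Real.mul_self_sqrt hpos]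
    · simp [S, mul_apply, apply_ite, hjk, hjk.symm]
  let B := fromRows S (diagonal fun j => (c j : 𝕜))
  let E := fromRows (0 : Matrix p q 𝕜) (1 : Matrix q q 𝕜)
  have hgram : Bᴴ * B = Eᴴ * E := by
    rw [conjTranspose_fromRows_eq_fromCols_conjTranspose, fromCols_mul_fromRows,
      conjTranspose_fromRows_eq_fromCols_conjTranspose, fromCols_mul_fromRows, hS,
      diagonal_conjTranspose, diagonal_mul_diagonal, diagonal_add, conjTranspose_zero,
      Matrix.zero_mul, zero_add, conjTranspose_one, Matrix.one_mul, ← diagonal_one]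
    congr! 2 with j
    simp [sq]
  obtain ⟨V, hV, h⟩ := exists_mem_unitaryGroup_eq_mul_of_conjTranspose_mul_self_eq hgram
  rw [mul_fromRows_zero_one] at h
  exact ⟨V, hV, (fromRows_inj h).2.symm⟩

theorem exists_eq_fromBlocks_mul_mul_fromBlocks_toBlocks₂₂_eq_diagonal
    {U : Matrix (p ⊕ q) (p ⊕ q) 𝕜} (hU : U ∈ unitaryGroup (p ⊕ q) 𝕜) :
    ∃ Y ∈ unitaryGroup q 𝕜, ∃ M ∈ unitaryGroup (p ⊕ q) 𝕜, ∃ Z ∈ unitaryGroup q 𝕜, ∃ c : q → ℝ,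
      (∀ j, |c j| ≤ 1) ∧ M.toBlocks₂₂ = diagonal (fun j => (c j : 𝕜)) ∧
        U = fromBlocks 1 0 0 Y * M * fromBlocks 1 0 0 Z := by
  obtain ⟨Y, hY, Z, hZ, c, hc⟩ := exists_singular_value_decomposition U.toBlocks₂₂
  have hD {X : Matrix q q 𝕜} (hX : X ∈ unitaryGroup q 𝕜) :
      fromBlocks (1 : Matrix p p 𝕜) 0 0 X ∈ unitaryGroup (p ⊕ q) 𝕜 :=
    fromBlocks_mem_unitaryGroup (one_mem _) hX
  let M := star (fromBlocks 1 0 0 Y) * U * star (fromBlocks 1 0 0 Z)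
  have hM : M ∈ unitaryGroup (p ⊕ q) 𝕜 :=
    mul_mem (mul_mem (Unitary.star_mem (hD hY)) hU) (Unitary.star_mem (hD hZ))
  have hM₂₂ : M.toBlocks₂₂ = diagonal fun j => (c j : 𝕜) := by
    have hcorner : M.toBlocks₂₂ = star Y * U.toBlocks₂₂ * star Z := by
      simp only [M]
      nth_rw 1 [← fromBlocks_toBlocks U]
      simp [star_eq_conjTranspose, fromBlocks_conjTranspose, fromBlocks_multiply]
    rw [hcorner, hc, mul_assoc, mul_assoc, Unitary.mul_star_self_of_mem hZ, mul_one, ← mul_assoc,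
      Unitary.star_mul_self_of_mem hY, one_mul]
  refine ⟨Y, hY, M, hM, Z, hZ, c, fun j => ?_, hM₂₂, ?_⟩
  · have hentry : M (Sum.inr j) (Sum.inr j) = c j := by
      exact (congrFun₂ hM₂₂ j j).trans (diagonal_apply_eq _ j)
    simpa [hentry] using entry_norm_bound_of_unitary hM (Sum.inr j) (Sum.inr j)
  · simp only [M, mul_assoc, Unitary.star_mul_self_of_mem (hD hZ), mul_one]
    rw [← mul_assoc, Unitary.mul_star_self_of_mem (hD hY), one_mul]

end CosineSine

section AlternatingProducts

variable {m m₁ m₂ n R : Type*}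

section DirectSum

variable [CommRing R]

/-- The direct sum of two operators with respect to a decomposition of the first party into two
parts. -/
def directSumA (U₁ : Matrix (m₁ × n) (m₁ × n) R) (U₂ : Matrix (m₂ × n) (m₂ × n) R) :
    Matrix ((m₁ ⊕ m₂) × n) ((m₁ ⊕ m₂) × n) R :=
  (fromBlocks U₁ 0 0 U₂).submatrix (Equiv.sumProdDistrib m₁ m₂ n) (Equiv.sumProdDistrib m₁ m₂ n)

variable [Fintype m₁] [Fintype m₂] [Fintype n]

theorem directSumA_mul (U₁ U₁' : Matrix (m₁ × n) (m₁ × n) R)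
    (U₂ U₂' : Matrix (m₂ × n) (m₂ × n) R) :
    directSumA (U₁ * U₁') (U₂ * U₂') = directSumA U₁ U₂ * directSumA U₁' U₂' := by
  rw [directSumA, directSumA, directSumA, submatrix_mul_equiv, fromBlocks_multiply]
  simp

variable [DecidableEq m₁] [DecidableEq m₂] [DecidableEq n]

theorem directSumA_controlledA (W₁ : m₁ → Matrix n n R)
    (W₂ : m₂ → Matrix n n R) :
    directSumA (controlledA W₁) (controlledA W₂) = controlledA (Sum.elim W₁ W₂) := by
  ext ⟨i | i, j⟩ ⟨i' | i', j'⟩ <;> simp [directSumA, controlledA_apply]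

theorem directSumA_controlledB (V₁ : n → Matrix m₁ m₁ R)
    (V₂ : n → Matrix m₂ m₂ R) :
    directSumA (controlledB V₁) (controlledB V₂) =
      controlledB fun j => fromBlocks (V₁ j) 0 0 (V₂ j) := by
  ext ⟨i | i, j⟩ ⟨i' | i', j'⟩ <;> simp [directSumA, controlledB_apply]

theorem toBlocks₂₂_submatrix_controlledB
    {V : n → Matrix (m₁ ⊕ m₂) (m₁ ⊕ m₂) R} {c : m₂ × n → R}
    (hV : ∀ j, (V j).toBlocks₂₂ = diagonal fun i => c (i, j)) :
    ((controlledB V).submatrix (Equiv.sumProdDistrib m₁ m₂ n).symm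
      (Equiv.sumProdDistrib m₁ m₂ n).symm).toBlocks₂₂ = diagonal c := by
  ext ⟨i, j⟩ ⟨i', j'⟩
  obtain rfl | hj := eq_or_ne j j'
  · have hentry : V j (Sum.inr i) (Sum.inr i') = diagonal (fun i => c (i, j)) i i' :=
      congrFun₂ (hV j) i i'
    simp [toBlocks₂₂, controlledB_apply, hentry, diagonal_apply]
  · simp [toBlocks₂₂, controlledB_apply, hj]

end DirectSum

section Recursion

variable [Fintype m] [Fintype m₁] [Fintype m₂] [Fintype n]
  [DecidableEq m] [DecidableEq m₁] [DecidableEq m₂] [DecidableEq n] [CommRing R] [StarRing R]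

/-- Alternating products of `2 ^ k` unitaries controlled by the first party and `2 ^ k - 1`
unitaries controlled by the second party. -/
def IsAlternatingProduct : ℕ → Matrix (m × n) (m × n) R → Prop
  | 0, U => ∃ W : m → Matrix n n R, (∀ i, W i ∈ unitaryGroup n R) ∧ U = controlledA W
  | k + 1, U => ∃ U₁ V U₂, IsAlternatingProduct k U₁ ∧ (∀ j, V j ∈ unitaryGroup m R) ∧
      IsAlternatingProduct k U₂ ∧ U = U₁ * controlledB V * U₂

theorem submatrix_equiv_mem_unitaryGroup (e : m₁ ≃ m₂) {U : Matrix m₂ m₂ R}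
    (hU : U ∈ unitaryGroup m₂ R) : U.submatrix e e ∈ unitaryGroup m₁ R := by
  rw [mem_unitaryGroup_iff, star_eq_conjTranspose] at *
  rw [conjTranspose_submatrix, submatrix_mul_equiv, hU, submatrix_one_equiv]

theorem IsAlternatingProduct.directSumA {k : ℕ} {U₁ : Matrix (m₁ × n) (m₁ × n) R}
    {U₂ : Matrix (m₂ × n) (m₂ × n) R} (h₁ : IsAlternatingProduct k U₁)
    (h₂ : IsAlternatingProduct k U₂) : IsAlternatingProduct k (directSumA U₁ U₂) := by
  induction k generalizing U₁ U₂ with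
  | zero =>
    obtain ⟨W₁, hW₁, rfl⟩ := h₁
    obtain ⟨W₂, hW₂, rfl⟩ := h₂
    exact ⟨Sum.elim W₁ W₂, Sum.forall.2 ⟨hW₁, hW₂⟩, directSumA_controlledA W₁ W₂⟩
  | succ k ih =>
    obtain ⟨U₁, V₁, U₁', hU₁, hV₁, hU₁', rfl⟩ := h₁
    obtain ⟨U₂, V₂, U₂', hU₂, hV₂, hU₂', rfl⟩ := h₂
    exact ⟨_, _, _, ih hU₁ hU₂, fun j => fromBlocks_mem_unitaryGroup (hV₁ j) (hV₂ j),
      ih hU₁' hU₂', by rw [directSumA_mul, directSumA_mul, directSumA_controlledB]⟩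

theorem IsAlternatingProduct.submatrix {k : ℕ} (e : m₁ ≃ m₂) {U : Matrix (m₂ × n) (m₂ × n) R}
    (h : IsAlternatingProduct k U) :
    IsAlternatingProduct k
      (U.submatrix (e.prodCongr (Equiv.refl n)) (e.prodCongr (Equiv.refl n))) := by
  induction k generalizing U with
  | zero =>
    obtain ⟨W, hW, rfl⟩ := h
    refine ⟨W ∘ e, fun i => hW _, ?_⟩
    ext ⟨i, j⟩ ⟨i', j'⟩
    simp [controlledA_apply]
  | succ k ih =>
    obtain ⟨U₁, V, U₂, hU₁, hV, hU₂, rfl⟩ := h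
    refine ⟨_, fun j => (V j).submatrix e e, _, ih hU₁,
      fun j => submatrix_equiv_mem_unitaryGroup e (hV j), ih hU₂, ?_⟩
    rw [← submatrix_mul_equiv _ _ _ (e.prodCongr (Equiv.refl n)),
      ← submatrix_mul_equiv _ _ _ (e.prodCongr (Equiv.refl n))]
    rfl

theorem isAlternatingProduct_zero [Subsingleton m] {U : Matrix (m × n) (m × n) R}
    (hU : U ∈ unitaryGroup (m × n) R) : IsAlternatingProduct 0 U := by
  refine ⟨fun i => U.submatrix (fun j => (i, j)) fun j => (i, j), fun i => ?_, ?_⟩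
  · have : Unique m := uniqueOfSubsingleton i
    have hprod : (fun j : n => (i, j)) = (Equiv.uniqueProd n m).symm :=
      funext fun j => Prod.ext (Subsingleton.elim _ _) rfl
    simpa only [hprod] using submatrix_equiv_mem_unitaryGroup _ hU
  · ext ⟨i, j⟩ ⟨i', j'⟩
    obtain rfl : i = i' := Subsingleton.elim _ _
    simp [controlledA_apply]

end Recursion

section Existence

variable [Fintype m₁] [Fintype m₂] [Fintype n] [DecidableEq m₁] [DecidableEq m₂] [DecidableEq n]
  {𝕜 : Type*} [RCLike 𝕜]

theorem exists_eq_directSumA_mul_controlledB_mul_directSumA (e : m₂ ↪ m₁)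
    {U : Matrix ((m₁ ⊕ m₂) × n) ((m₁ ⊕ m₂) × n) 𝕜}
    (hU : U ∈ unitaryGroup ((m₁ ⊕ m₂) × n) 𝕜) :
    ∃ W ∈ unitaryGroup (m₁ × n) 𝕜, ∃ Y ∈ unitaryGroup (m₂ × n) 𝕜,
      ∃ V : n → Matrix (m₁ ⊕ m₂) (m₁ ⊕ m₂) 𝕜, (∀ j, V j ∈ unitaryGroup (m₁ ⊕ m₂) 𝕜) ∧
        ∃ W' ∈ unitaryGroup (m₁ × n) 𝕜, ∃ Y' ∈ unitaryGroup (m₂ × n) 𝕜,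
          U = directSumA W Y * controlledB V * directSumA W' Y' := by
  let s := Equiv.sumProdDistrib m₁ m₂ n
  obtain ⟨Y, hY, M, hM, Y', hY', c, hc, hM₂₂, hUM⟩ :=
    exists_eq_fromBlocks_mul_mul_fromBlocks_toBlocks₂₂_eq_diagonal
      (submatrix_equiv_mem_unitaryGroup s.symm hU)
  choose V hV hV₂₂ using fun j => exists_mem_unitaryGroup_toBlocks₂₂_eq_diagonal (𝕜 := 𝕜) e
    fun i => hc (i, j)
  obtain ⟨W, hW, W', hW', hMV⟩ := exists_eq_fromBlocks_mul_mul_fromBlocks_of_toBlocks₂₂_eq hM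
    (submatrix_equiv_mem_unitaryGroup s.symm (controlledB_mem_unitaryGroup hV))
    (hM₂₂.trans (toBlocks₂₂_submatrix_controlledB (c := fun i => (c i : 𝕜)) hV₂₂).symm)
  refine ⟨W, hW, Y, hY, V, hV, W', hW', Y', hY', ?_⟩
  have hsplit : U.submatrix s.symm s.symm =
      fromBlocks W 0 0 Y * (controlledB V).submatrix s.symm s.symm * fromBlocks W' 0 0 Y' := by
    have hl : fromBlocks 1 0 0 Y * fromBlocks W 0 0 1 = fromBlocks W 0 0 Y := by
      simp [fromBlocks_multiply]
    have hr : fromBlocks W' 0 0 1 * fromBlocks 1 0 0 Y' = fromBlocks W' 0 0 Y' := by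
      simp [fromBlocks_multiply]
    rw [hUM, hMV, ← hl, ← hr]
    simp only [Matrix.mul_assoc]
  have hback := congrArg (fun X => X.submatrix s s) hsplit
  simp only [submatrix_submatrix, Equiv.symm_comp_self, submatrix_id_id] at hback
  rw [hback, ← submatrix_mul_equiv _ _ _ s, ← submatrix_mul_equiv _ _ _ s, submatrix_submatrix,
    Equiv.symm_comp_self, submatrix_id_id]
  rfl

theorem isAlternatingProduct_of_mem_unitaryGroup {d k : ℕ} (hd : d ≤ 2 ^ k)
    {U : Matrix (Fin d × n) (Fin d × n) 𝕜} (hU : U ∈ unitaryGroup (Fin d × n) 𝕜) :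
    IsAlternatingProduct k U := by
  induction k generalizing d with
  | zero =>
    have : Subsingleton (Fin d) := Fin.subsingleton_iff_le_one.2 (by simpa using hd)
    exact isAlternatingProduct_zero hU
  | succ k ih =>
    obtain ⟨a, b, hba, rfl, ha, hb⟩ : ∃ a b, b ≤ a ∧ a + b = d ∧ a ≤ 2 ^ k ∧ b ≤ 2 ^ k :=
      ⟨d - d / 2, d / 2, by lia, by lia, by lia, by lia⟩
    let f : Fin a ⊕ Fin b ≃ Fin (a + b) := finSumFinEquiv
    obtain ⟨W, hW, Y, hY, V, hV, W', hW', Y', hY', h⟩ :=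
      exists_eq_directSumA_mul_controlledB_mul_directSumA (Fin.castLEEmb hba)
        (submatrix_equiv_mem_unitaryGroup (f.prodCongr (Equiv.refl n)) hU)
    have hsum : IsAlternatingProduct (k + 1) (U.submatrix (f.prodCongr (Equiv.refl n))
        (f.prodCongr (Equiv.refl n))) :=
      ⟨_, V, _, (ih ha hW).directSumA (ih hb hY), hV, (ih ha hW').directSumA (ih hb hY'), h⟩
    convert hsum.submatrix f.symm
    ext ⟨i, j⟩ ⟨i', j'⟩
    simp

end Existence

section GateCount

variable {dA dB : ℕ}

theorem IsAlternatingProduct.isProductOfAtMost {k : ℕ} {U : BipartiteMatrix dA dB}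
    (hU : IsAlternatingProduct k U) :
    IsProductOfAtMost IsStandardGate (localUnitaries dA dB)
      (2 ^ k * ((dA - 1) * (dB / 2)) + (2 ^ k - 1) * ((dB - 1) * (dA / 2))) U := by
  induction k generalizing U with
  | zero =>
    obtain ⟨W, hW, rfl⟩ := hU
    simpa using isProductOfAtMost_controlledA hW
  | succ k ih =>
    obtain ⟨U₁, V, U₂, hU₁, hV, hU₂, rfl⟩ := hU
    refine (((ih hU₁).mul (isProductOfAtMost_controlledB hV)).mul (ih hU₂)).mono (le_of_eq ?_)
    obtain ⟨t, ht⟩ : ∃ t, 2 ^ k = t + 1 := Nat.exists_eq_succ_of_ne_zero (by positivity)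
    have hsub : 2 ^ k - 1 = t := by lia
    have hsub_succ : 2 ^ (k + 1) - 1 = 2 * t + 1 := by lia
    rw [hsub, hsub_succ, pow_succ, ht]
    ring

theorem two_pow_clog_le {d : ℕ} (hd : 2 ≤ d) : 2 ^ Nat.clog 2 d ≤ 2 * (d - 1) := by
  have hlt := Nat.pow_pred_clog_lt_self one_lt_two hd
  rw [← Nat.succ_pred_eq_of_pos (Nat.clog_pos one_lt_two hd), pow_succ]
  lia

theorem isProductOfAtMost_of_mem_unitaryGroup {U : BipartiteMatrix dA dB}
    (hU : U ∈ unitaryGroup (Fin dA × Fin dB) ℂ) :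
    IsProductOfAtMost IsStandardGate (localUnitaries dA dB)
      (2 * (dA - 1) ^ 2 * (dB / 2) + (2 * dA - 3) * (dB - 1) * (dA / 2)) U := by
  refine (isAlternatingProduct_of_mem_unitaryGroup (Nat.le_pow_clog one_lt_two dA)
    hU).isProductOfAtMost.mono ?_
  obtain hA | hA := le_or_gt dA 1
  · simp [Nat.sub_eq_zero_of_le hA, Nat.div_eq_of_lt (Nat.lt_succ_of_le hA)]
  have hfactors := two_pow_clog_le hA
  calc _ ≤ 2 * (dA - 1) * ((dA - 1) * (dB / 2)) + (2 * dA - 3) * ((dB - 1) * (dA / 2)) := by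
        gcongr ?_ * _ + ?_ * _
        lia
    _ = _ := by ring

end GateCount

end AlternatingProducts

/-- For `dA = 1` the truncated factor `2 * dA - 3` is multiplied by `dA / 2 = 0`, so that the
natural-number counts agree with the integer ones for all `dA, dB ≥ 1`. -/
theorem proposition4 (dA dB : ℕ) (hA : 1 ≤ dA) (hB : 1 ≤ dB) :
    -- arbitrary bipartite unitaries
    (∀ U : BipartiteMatrix dA dB, U ∈ Matrix.unitaryGroup (Fin dA × Fin dB) ℂ →
      ∃ n : ℕ, n ≤ 2 * (dA - 1) ^ 2 * (dB / 2) + (2 * dA - 3) * (dB - 1) * (dA / 2) ∧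
        IsProductOfGates IsStandardGate IsLocalUnitary n U) ∧
    -- controlled unitaries controlled from the A side
    (∀ U : BipartiteMatrix dA dB, IsControlledFromA U →
      ∃ n : ℕ, n ≤ (dA - 1) * (dB / 2) ∧
        IsProductOfGates IsStandardGate IsLocalUnitary n U) ∧
    -- complex permutation unitaries
    (∀ U : BipartiteMatrix dA dB, IsComplexPermutation U →
      ∃ n : ℕ, n ≤ 2 * (dA - 1) * (dB / 2) + (dB - 1) * (dA / 2) ∧
        IsProductOfGates IsStandardGate IsLocalUnitary n U) ∧
    -- permutation unitaries, with CNOT-type standard gates and local permutation gates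
    (∀ σ : Equiv.Perm (Fin dA × Fin dB),
      ∃ n : ℕ, n ≤ 3 * (dA - 1) * (dB - 1) ∧
        IsProductOfGates IsCNOTGate IsLocalPermutation n (σ.permMatrix ℂ)) := by
  refine ⟨fun U hU => isProductOfAtMost_of_mem_unitaryGroup hU, ?_,
    fun U hU => hU.isProductOfAtMost, isProductOfAtMost_permMatrix⟩
  rintro _ ⟨K, L, W, hK, hL, hW, rfl⟩
  rw [← controlledA_eq_sum]
  exact ((isProductOfAtMost_controlledA hW).local_mul hK).mul_local hL
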